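/- Let $X$ and $Y$ be arbitrary metric spaces (no compactness is assumed), let $\mathbb{K}$ be a commutative ring, let $n\ge 0$ and let $p\in[1,\infty]$. **Weights.** The $\ell_p$-weight of a tuple of points is $$w_p(x_0,\dots,x_m)=\max_{0\le i_0<\dots<i_k\le m}\bigl\|\bigl(d(x_{i_0},x_{i_1}),\dots,d(x_{i_{k-1}},x_{i_k})\bigr)\bigr\|_p ,$$ and the $\ell_p$-weight of a finite non-empty set $\tau$ of $m+1$ points is the minimum of $w_p(x_0,\dots,x_m)$ over all orderings $x_0,\dots,x_m$ of its points. **Spaces.** For $r\in\mathbb{R}$, the $\ell_p$-Vietoris–Rips simplicial set $\mathscr{VR}^p_{<r}X$ has as its $m$-simplices all tuples $(x_0,\dots,x_m)$ with $w_p(x_0,\dots,x_m)<r$; faces delete entries and degeneracies repeat entries. The $\ell_p$-Vietoris–Rips complex $\mathtt{VR}^p_{<r}X$ is the abstract simplicial complex of finite non-empty subsets of $X$ of $\ell_p$-weight less than $r$. The (strictly) blurred magnitude homology $\mathsf{MH}_{n,<r}(X)$ is $H_n$ of the simplicial set of tuples $(x_0,\dots,x_m)$ with $d(x_0,x_1)+\dots+d(x_{m-1},x_m)<r$.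 The non-strict versions $\mathscr{VR}^p_{\le r}X$, $\mathtt{VR}^p_{\le r}X$, $\mathsf{MH}_{n,\le r}(X)$ are obtained by replacing $<r$ by $\le r$. Here $H_n(-)=H_n(-;\mathbb{K})$ is simplicial homology. As $r$ varies over $\mathbb{R}$, with the maps induced by inclusions, these homology modules form persistence modules, i.e. functors from the poset $\mathbb{R}$ to $\mathbb{K}$-modules. **Distances.** For $c\in\mathbb{R}$ let $P[c](r)=P(r+c)$. For $c>0$, persistence modules $P,Q$ are $c$-interleaved if there are natural transformations $\varphi:P\to Q[c]$ and $\psi:Q\to P[c]$ such that $\psi[c]\circ\varphi$ and $\varphi[c]\circ\psi$ are the structure maps $P\to P[2c]$ and $Q\to Q[2c]$; and $d_{\mathsf{int}}(P,Q)\in[0,\infty]$ is the infimum of the $c>0$ such that $P$ and $Q$ are $c$-interleaved. The Gromov–Hausdorff distance $d_{GH}(X,Y)\in[0,\infty]$ is the infimum of the Hausdorff distances of $i(X)$ and $j(Y)$ over all isometric embeddings $i:X\to Z$, $j:Y\to Z$ into a metric space $Z$. **Statement.** With the convention $(n+2)^{1/\infty}=1$, $$d_{\mathsf{int}}\bigl(H_n(\mathscr{VR}^p_{<*}X),H_n(\mathscr{VR}^p_{<*}Y)\bigr)\le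 2(n+2)^{1/p}\,d_{GH}(X,Y),$$ $$d_{\mathsf{int}}\bigl(H_n(\mathtt{VR}^p_{<*}X),H_n(\mathtt{VR}^p_{<*}Y)\bigr)\le 2(n+2)^{1/p}\,d_{GH}(X,Y),$$ $$d_{\mathsf{int}}\bigl(\mathsf{MH}_{n,<*}(X),\mathsf{MH}_{n,<*}(Y)\bigr)\le 2(n+2)\,d_{GH}(X,Y),$$ and the same three inequalities hold for the non-strict versions $H_n(\mathscr{VR}^p_{\le *}-)$, $H_n(\mathtt{VR}^p_{\le *}-)$ and $\mathsf{MH}_{n,\le *}(-)$. -/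

import Mathlib

open CategoryTheory

universe u v w

namespace LpVR

/-! ### The Gromov–Hausdorff distance -/

/-- The Gromov–Hausdorff distance of two arbitrary (not necessarily compact) metric spaces, with
values in `[0, ∞]`: the infimum of the Hausdorff distances of `i(X)` and `j(Y)` over all isometric
embeddings `i : X → Z` and `j : Y → Z` into a common metric space. -/
noncomputable def ghEDist (X Y : Type u) [MetricSpace X] [MetricSpace Y] : ENNReal :=
  ⨅ (Z : Type u) (_ : MetricSpace Z) (i : X → Z) (_ : Isometry i) (j : Y → Z) (_ : Isometry j),
    Metric.hausdorffEDist (Set.range i) (Set.range j)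

/-! ### Persistent objects and the interleaving distance -/

section Interleaving

variable {C : Type v} [Category.{w} C]

/-- Translation by `c` as an endofunctor of the poset `ℝ`. -/
def shift (c : ℝ) : ℝ ⥤ ℝ :=
  Monotone.functor (f := fun r : ℝ => r + c) (fun _ _ h => by simpa using h)

/-- The natural transformation `P ⟶ P[c][c]` given by the structure maps `P r ⟶ P (r + c + c)`. -/
def shiftTwice (P : ℝ ⥤ C) (c : ℝ) (hc : 0 ≤ c) : P ⟶ shift c ⋙ shift c ⋙ P where
  app r := P.map (homOfLE (show r ≤ r + c + c by linarith))
  naturality r s h := by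
    simp only [Functor.comp_map, ← P.map_comp]
    rfl

/-- Two persistent objects `P, Q : ℝ ⥤ C` are `c`-interleaved if there are `φ : P ⟶ Q[c]` and
`ψ : Q ⟶ P[c]` such that `ψ[c] ∘ φ` and `φ[c] ∘ ψ` are the structure maps `P ⟶ P[2c]`, `Q ⟶ Q[2c]`. -/
def Interleaved (c : ℝ) (hc : 0 ≤ c) (P Q : ℝ ⥤ C) : Prop :=
  ∃ (φ : P ⟶ shift c ⋙ Q) (ψ : Q ⟶ shift c ⋙ P),
    φ ≫ Functor.whiskerLeft (shift c) ψ = shiftTwice P c hc ∧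
    ψ ≫ Functor.whiskerLeft (shift c) φ = shiftTwice Q c hc

/-- The interleaving distance, with values in `[0, ∞]`. -/
noncomputable def interleavingDist (P Q : ℝ ⥤ C) : ENNReal :=
  ⨅ (c : ℝ) (hc : 0 < c) (_ : Interleaved c hc.le P Q), ENNReal.ofReal c

end Interleaving

/-! ### Simplicial chains of an abstract simplicial complex -/

section OrientedChains

variable {ι : Type u}

open Classical in
/-- The tuples `(x₀, …, xₙ)`, possibly with repetitions, whose entries span a simplex of `K`. -/
def Tuple (K : PreAbstractSimplicialComplex ι) (n : ℕ) : Type u :=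
  {x : Fin (n + 1) → ι // Finset.univ.image x ∈ K.faces}

variable {K L M : PreAbstractSimplicialComplex ι} {n : ℕ}

/-- Permuting the entries. -/
def Tuple.perm (x : Tuple K n) (π : Equiv.Perm (Fin (n + 1))) : Tuple K n :=
  ⟨x.1 ∘ π, by
    classical
    have h : Finset.univ.image (x.1 ∘ π) = Finset.univ.image x.1 := by
      ext a
      simp only [Finset.mem_image, Finset.mem_univ, true_and, Function.comp]
      exact π.exists_congr_left.trans (by simp)
    have := x.2
    convert h ▸ this⟩

/-- Deleting the `i`-th entry. -/
def Tuple.face (x : Tuple K (n + 1)) (i : Fin (n + 2)) : Tuple K n :=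
  ⟨x.1 ∘ i.succAbove, by
    classical
    refine (K.isRelLowerSet_faces x.2).2 ?_ (by simp)
    intro a
    simp only [Finset.mem_image, Finset.mem_univ, true_and, Function.comp]
    rintro ⟨j, rfl⟩
    exact ⟨_, rfl⟩⟩

/-- The inclusion of a subcomplex on tuples. -/
def Tuple.incl (h : K ≤ L) (x : Tuple K n) : Tuple L n := ⟨x.1, h x.2⟩

variable (R : Type v) [CommRing R]

/-- The relations between ordered tuples that define oriented chains: a tuple with a repeated
vertex is zero, and permuting the entries multiplies a tuple by the sign of the permutation. -/
noncomputable def orientationRel (K : PreAbstractSimplicialComplex ι) (n : ℕ) : Submodule R (Tuple K n →₀ R) :=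
  Submodule.span R
    ({c | ∃ x : Tuple K n, ¬ Function.Injective x.1 ∧ c = Finsupp.single x 1} ∪
     {c | ∃ (x : Tuple K n) (π : Equiv.Perm (Fin (n + 1))),
        c = Finsupp.single (x.perm π) 1 - ((Equiv.Perm.sign π : ℤ) : R) • Finsupp.single x 1})

/-- The module of oriented simplicial `n`-chains of `K` with coefficients in `R`. -/
abbrev OrientedChains (K : PreAbstractSimplicialComplex ι) (n : ℕ) : Type (max u v) :=
  (Tuple K n →₀ R) ⧸ orientationRel R K n

/-- The boundary `∂(x₀, …, xₙ₊₁) = ∑ (-1)ⁱ (x₀, …, x̂ᵢ, …, xₙ₊₁)` on ordered tuples. -/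
noncomputable def tupleBoundary (K : PreAbstractSimplicialComplex ι) (n : ℕ) :
    (Tuple K (n + 1) →₀ R) →ₗ[R] (Tuple K n →₀ R) :=
  Finsupp.linearCombination R
    (fun x => ∑ i : Fin (n + 2), (-1 : R) ^ (i : ℕ) • Finsupp.single (x.face i) 1)

lemma tupleBoundary_single (x : Tuple K (n + 1)) :
    tupleBoundary R K n (Finsupp.single x 1) =
      ∑ i : Fin (n + 2), (-1 : R) ^ (i : ℕ) • Finsupp.single (x.face i) 1 := by
  simp [tupleBoundary]

lemma tupleBoundary_tupleBoundary (c : Tuple K (n + 2) →₀ R) :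
    tupleBoundary R K n (tupleBoundary R K (n + 1) c) = 0 := by
  suffices h : tupleBoundary R K n ∘ₗ tupleBoundary R K (n + 1) = 0 from
    LinearMap.congr_fun h c
  ext1 x
  ext1
  simp only [LinearMap.comp_apply, Finsupp.lsingle_apply, tupleBoundary_single, map_sum, map_smul,
    LinearMap.zero_apply, Finset.smul_sum, smul_smul, ← pow_add]
  rw [← Fintype.sum_prod_type']
  refine Finset.sum_involution
    (fun a _ => (a.1.succAbove a.2, a.2.predAbove a.1)) ?_ ?_ ?_ ?_
  · rintro ⟨i, j⟩ -
    have hf : (x.face (i.succAbove j)).face (j.predAbove i) = (x.face i).face j := by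
      apply Subtype.ext
      funext k
      simp only [Tuple.face, Function.comp]
      rw [Fin.succAbove_succAbove_succAbove_predAbove]
    have hs := Fin.neg_one_pow_succAbove_add_predAbove (R := R) i j
    simp only
    rw [hf, hs, neg_smul, add_neg_cancel]
  · rintro ⟨i, j⟩ - - h
    exact Fin.succAbove_ne i j (congrArg Prod.fst h)
  · simp
  · rintro ⟨i, j⟩ -
    exact Prod.ext (Fin.succAbove_succAbove_predAbove i j) (Fin.predAbove_predAbove_succAbove i j)

lemma exists_perm_succAbove (π : Equiv.Perm (Fin (n + 2))) (i : Fin (n + 2)) :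
    ∃ σ : Equiv.Perm (Fin (n + 1)), (∀ j, π (i.succAbove j) = (π i).succAbove (σ j)) ∧
      ((Equiv.Perm.sign σ : ℤ) : R) =
        ((Equiv.Perm.sign π : ℤ) : R) * (-1) ^ (i : ℕ) * (-1) ^ ((π i : Fin (n + 2)) : ℕ) := by
  set ρ : Equiv.Perm (Fin (n + 2)) := (π i).cycleRange * π * (i.cycleRange)⁻¹ with hρ
  obtain ⟨⟨p, σ⟩, hσ⟩ := Equiv.Perm.decomposeFin.symm.surjective ρ
  have h0 : ρ 0 = 0 := by
    simp [hρ, Equiv.Perm.mul_apply, Equiv.Perm.inv_def]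
  have hp : p = 0 := by
    rw [← h0, ← hσ]; simp
  subst hp
  have hsucc : ∀ j : Fin (n + 1), ρ j.succ = (σ j).succ := by
    intro j
    rw [← hσ]; simp
  refine ⟨σ, fun j => ?_, ?_⟩
  · have := hsucc j
    simp only [hρ, Equiv.Perm.mul_apply, Equiv.Perm.inv_def, Fin.cycleRange_symm_succ] at this
    rw [← Fin.cycleRange_symm_succ (π i), ← this, Equiv.symm_apply_apply]
  · have h1 : Equiv.Perm.sign σ = Equiv.Perm.sign ρ := by
      rw [← hσ]; simp
    rw [h1, hρ]
    simp only [map_mul, map_inv, Fin.sign_cycleRange]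
    push_cast
    have : (((((-1 : ℤˣ) ^ (i : ℕ))⁻¹ : ℤˣ) : ℤ) : R) = (-1) ^ (i : ℕ) := by
      rw [← inv_pow]; simp
    simp
    ring

lemma orientationRel_le_comap (K : PreAbstractSimplicialComplex ι) (n : ℕ) :
    orientationRel R K (n + 1) ≤ (orientationRel R K n).comap (tupleBoundary R K n) := by
  have key : ∀ (x : Tuple K (n + 1)) (π : Equiv.Perm (Fin (n + 2))) (i : Fin (n + 2)),
      (Finsupp.single ((x.perm π).face i) 1 : Tuple K n →₀ R) -
        (((Equiv.Perm.sign π : ℤ) : R) * (-1) ^ (i : ℕ) * (-1) ^ ((π i : Fin (n + 2)) : ℕ)) •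
          Finsupp.single (x.face (π i)) 1 ∈ orientationRel R K n := by
    intro x π i
    obtain ⟨σ, h1, h2⟩ := exists_perm_succAbove R π i
    rw [← h2]
    have : (x.perm π).face i = (x.face (π i)).perm σ :=
      Subtype.ext (funext fun j => congrArg x.1 (h1 j))
    rw [this]
    exact Submodule.subset_span (Or.inr ⟨_, σ, rfl⟩)
  refine Submodule.span_le.2 ?_
  rintro c (⟨x, hx, rfl⟩ | ⟨x, π, rfl⟩)
  · simp only [SetLike.mem_coe, Submodule.mem_comap, tupleBoundary_single]
    simp only [Function.Injective, not_forall] at hx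
    obtain ⟨i, j, hij, hne⟩ := hx
    rw [← Finset.add_sum_erase _ _ (Finset.mem_univ i),
      ← Finset.add_sum_erase _ _ (Finset.mem_erase.2 ⟨Ne.symm hne, Finset.mem_univ j⟩), ← add_assoc]
    refine add_mem ?_ (sum_mem fun k hk => Submodule.smul_mem _ _ ?_)
    · have hx' : x.perm (Equiv.swap i j) = x := by
        apply Subtype.ext
        funext k
        simp only [Tuple.perm, Function.comp]
        rcases eq_or_ne k i with rfl | hki
        · rw [Equiv.swap_apply_left, hij]
        · rcases eq_or_ne k j with rfl | hkj
          · rw [Equiv.swap_apply_right, hij]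
          · rw [Equiv.swap_apply_of_ne_of_ne hki hkj]
      have := key x (Equiv.swap i j) i
      rw [hx', Equiv.swap_apply_left, Equiv.Perm.sign_swap hne] at this
      have := Submodule.smul_mem _ ((-1 : R) ^ (i : ℕ)) this
      rw [smul_sub, smul_smul] at this
      convert this using 1
      have e : (-1 : R) ^ (i : ℕ) * (-1) ^ (i : ℕ) = 1 := by
        rw [← mul_pow]; simp
      have e2 : (-1 : R) ^ (i : ℕ) * ((((-1 : ℤˣ) : ℤ) : R) * (-1) ^ (i : ℕ) * (-1) ^ (j : ℕ)) =
          - (-1) ^ (j : ℕ) := by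
        push_cast
        linear_combination (-(-1 : R) ^ (j : ℕ)) * e
      rw [e2, neg_smul, sub_neg_eq_add]
    · refine Submodule.subset_span (Or.inl ⟨_, ?_, rfl⟩)
      have hki : k ≠ i := (Finset.mem_erase.1 (Finset.mem_erase.1 hk).2).1
      have hkj : k ≠ j := (Finset.mem_erase.1 hk).1
      obtain ⟨a, ha⟩ := Fin.exists_succAbove_eq hki.symm
      obtain ⟨b, hb⟩ := Fin.exists_succAbove_eq hkj.symm
      intro hinj
      have : a = b := hinj (by simpa [Tuple.face, ha, hb] using hij)
      exact hne (by rw [← ha, ← hb, this])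
  · simp only [SetLike.mem_coe, Submodule.mem_comap, map_sub, map_smul, tupleBoundary_single]
    rw [← Equiv.sum_comp π (fun i => (-1 : R) ^ (i : ℕ) • (Finsupp.single (x.face i) 1 :
      Tuple K n →₀ R)), Finset.smul_sum, ← Finset.sum_sub_distrib]
    refine sum_mem fun i _ => ?_
    have := Submodule.smul_mem _ ((-1 : R) ^ (i : ℕ)) (key x π i)
    rw [smul_sub, smul_smul] at this
    convert this using 2
    rw [smul_smul]
    congr 1
    have e : (-1 : R) ^ (i : ℕ) * (-1) ^ (i : ℕ) = 1 := by
      rw [← mul_pow]; simp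
    linear_combination (-((Equiv.Perm.sign π : ℤ) : R) * (-1 : R) ^ ((π i : Fin (n + 2)) : ℕ)) * e

/-- The boundary of oriented chains. -/
noncomputable def orientedBoundary (K : PreAbstractSimplicialComplex ι) (n : ℕ) :
    OrientedChains R K (n + 1) →ₗ[R] OrientedChains R K n :=
  Submodule.mapQ _ _ (tupleBoundary R K n) (orientationRel_le_comap R K n)

/-- The oriented simplicial chain complex of `K` with coefficients in `R`. -/
noncomputable def orientedChainComplex (K : PreAbstractSimplicialComplex ι) :
    ChainComplex (ModuleCat.{max u v} R) ℕ :=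
  ChainComplex.of (fun n => ModuleCat.of R (OrientedChains R K n))
    (fun n => ModuleCat.ofHom (orientedBoundary R K n)) (fun n => by
      refine ModuleCat.hom_ext (LinearMap.ext fun x => ?_)
      obtain ⟨c, rfl⟩ := Submodule.Quotient.mk_surjective _ x
      simp [orientedBoundary, tupleBoundary_tupleBoundary])

lemma orientationRel_le_comap_incl (h : K ≤ L) (n : ℕ) :
    orientationRel R K n ≤
      (orientationRel R L n).comap (Finsupp.lmapDomain R R (Tuple.incl h)) := by
  refine Submodule.span_le.2 ?_
  rintro c (⟨x, hx, rfl⟩ | ⟨x, π, rfl⟩)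
  · refine Submodule.subset_span (Or.inl ⟨Tuple.incl h x, hx, ?_⟩)
    simp
  · refine Submodule.subset_span (Or.inr ⟨Tuple.incl h x, π, ?_⟩)
    simp only [map_sub, map_smul, Finsupp.lmapDomain_apply, Finsupp.mapDomain_single]
    rfl

/-- The map of oriented chains induced by an inclusion of simplicial complexes. -/
noncomputable def orientedIncl (h : K ≤ L) (n : ℕ) :
    OrientedChains R K n →ₗ[R] OrientedChains R L n :=
  Submodule.mapQ _ _ (Finsupp.lmapDomain R R (Tuple.incl h)) (orientationRel_le_comap_incl R h n)

lemma orientedIncl_comm (h : K ≤ L) (n : ℕ) :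
    orientedBoundary R L n ∘ₗ orientedIncl R h (n + 1) =
      orientedIncl R h n ∘ₗ orientedBoundary R K n := by
  ext x
  simp only [orientedBoundary, orientedIncl, LinearMap.comp_apply, Submodule.mkQ_apply,
    Submodule.mapQ_apply, Finsupp.lsingle_apply, tupleBoundary_single, map_sum, map_smul,
    Finsupp.lmapDomain_apply, Finsupp.mapDomain_single]
  rfl

variable (ι) in
/-- Oriented chains as a functor on the poset of simplicial complexes with vertices in `ι`. -/
noncomputable def orientedChainFunctor :
    PreAbstractSimplicialComplex ι ⥤ ChainComplex (ModuleCat.{max u v} R) ℕ where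
  obj K := orientedChainComplex R K
  map {K L} f := ChainComplex.ofHom
    (X := orientedChainComplex R K) (Y := orientedChainComplex R L)
    (fun n => ModuleCat.ofHom (orientedIncl R (leOfHom f) n)) (fun n => by
      simp only [orientedChainComplex, ChainComplex.of_d]
      exact congrArg ModuleCat.ofHom (orientedIncl_comm R (leOfHom f) n))
  map_id K := by
    ext n x
    obtain ⟨c, rfl⟩ := Submodule.Quotient.mk_surjective _ x
    change Submodule.Quotient.mk (Finsupp.mapDomain id c) = _
    rw [Finsupp.mapDomain_id]
    rfl
  map_comp {K L M} f g := by
    ext n x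
    obtain ⟨c, rfl⟩ := Submodule.Quotient.mk_surjective _ x
    change Submodule.Quotient.mk (Finsupp.mapDomain (Tuple.incl (leOfHom g) ∘
      Tuple.incl (leOfHom f)) c) = _
    rw [Finsupp.mapDomain_comp]
    rfl

variable (ι) in
/-- Simplicial homology `K ↦ Hₙ(K; R)` on the poset of simplicial complexes with vertices in `ι`. -/
noncomputable def complexHomology (n : ℕ) :
    PreAbstractSimplicialComplex ι ⥤ ModuleCat.{max u v} R :=
  orientedChainFunctor ι R ⋙ HomologicalComplex.homologyFunctor _ _ n

end OrientedChains

/-! ### Weights of tuples and of finite sets -/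

section Weights

variable {X : Type u} [MetricSpace X]

/-- The vector of consecutive distances `(d(y₀, y₁), …, d(yₘ₋₁, yₘ))`. -/
def steps {m : ℕ} (y : Fin (m + 1) → X) : Fin m → ℝ :=
  fun k => dist (y k.castSucc) (y k.succ)

/-- The `ℓ_p`-norm of a finite vector of real numbers. -/
noncomputable def lpNorm (p : ENNReal) {m : ℕ} (a : Fin m → ℝ) : ℝ := ‖WithLp.toLp p a‖

/-- The nonempty strictly increasing sequences `i₀ < … < iₘ` of positions in a `k`-tuple. -/
abbrev Chain (k : ℕ) : Type := Σ m : Fin k, Fin (m + 1) ↪o Fin k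

/-- The `ℓ_p`-weight of a tuple: the maximum over all `i₀ < … < iₘ` of the `ℓ_p`-norm of
`(d(x_{i₀}, x_{i₁}), …, d(x_{iₘ₋₁}, x_{iₘ}))`. The supremum is over a finite set. -/
noncomputable def weight (p : ENNReal) {k : ℕ} (x : Fin k → X) : ℝ :=
  ⨆ c : Chain k, lpNorm p (steps (x ∘ c.2))

/-- The `ℓ_p`-weight of a finite set: the minimum of the weights of its enumerations without
repetitions. The infimum is over a finite nonempty set. -/
noncomputable def finsetWeight (p : ENNReal) (τ : Finset X) : ℝ :=
  ⨅ e : Fin τ.card ≃ τ, weight p (fun i => (e i : X))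

lemma lpNorm_nonneg (p : ENNReal) {m : ℕ} (a : Fin m → ℝ) : 0 ≤ lpNorm p a := by
  rcases eq_or_ne p 0 with rfl | h0
  · simp [lpNorm, PiLp.norm_eq_card]
  rcases eq_or_ne p ⊤ with rfl | ht
  · simp only [lpNorm, PiLp.norm_eq_ciSup]
    exact Real.iSup_nonneg fun _ => norm_nonneg _
  · simp only [lpNorm, PiLp.norm_eq_sum (ENNReal.toReal_pos h0 ht)]
    positivity

lemma lpNorm_le_weight (p : ENNReal) {k : ℕ} (x : Fin k → X) {m : ℕ} (i : Fin (m + 1) ↪o Fin k) :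
    lpNorm p (steps (x ∘ i)) ≤ weight p x := by
  have hm : m < k := by
    have := Fintype.card_le_of_embedding i.toEmbedding
    simp at this; omega
  exact le_ciSup (f := fun c : Chain k => lpNorm p (steps (x ∘ c.2)))
    (Set.finite_range _).bddAbove ⟨⟨m, hm⟩, i⟩

lemma lpNorm_succAbove (p : ENNReal) {m : ℕ} (a : Fin (m + 1) → ℝ) (k : Fin (m + 1))
    (hk : a k = 0) : lpNorm p a ≤ lpNorm p (a ∘ k.succAbove) := by
  rcases eq_or_ne p 0 with rfl | h0
  · simp only [lpNorm, PiLp.norm_eq_card, Nat.cast_le]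
    refine Finset.card_le_card_of_surjOn k.succAbove ?_
    intro j hj
    have hj' : a j ≠ 0 := by simpa using hj
    have hne : j ≠ k := fun h => hj' (h ▸ hk)
    obtain ⟨b, rfl⟩ := Fin.exists_succAbove_eq hne
    exact ⟨b, by simpa using hj', rfl⟩
  rcases eq_or_ne p ⊤ with rfl | ht
  · simp only [lpNorm, PiLp.norm_eq_ciSup]
    refine ciSup_le fun j => ?_
    rcases eq_or_ne j k with rfl | hne
    · simp only [hk, norm_zero]
      exact Real.iSup_nonneg fun _ => norm_nonneg _
    · obtain ⟨b, rfl⟩ := Fin.exists_succAbove_eq hne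
      exact le_ciSup (f := fun b => ‖a (k.succAbove b)‖) (Set.finite_range _).bddAbove b
  · have hp := ENNReal.toReal_pos h0 ht
    simp only [lpNorm, PiLp.norm_eq_sum hp]
    rw [Fin.sum_univ_succAbove _ k]
    simp [hk, Real.zero_rpow hp.ne']

lemma lpNorm_le_weight_of_monotone (p : ENNReal) {k : ℕ} (x : Fin k → X) :
    ∀ {m : ℕ} (i : Fin (m + 1) → Fin k), Monotone i → lpNorm p (steps (x ∘ i)) ≤ weight p x := by
  intro m
  induction m with
  | zero =>
    intro i _
    exact lpNorm_le_weight p x (OrderEmbedding.ofStrictMono i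
      (fun a b h => by simp only [Fin.lt_def] at h; omega))
  | succ m ih =>
    intro i hi
    by_cases h : ∀ j : Fin (m + 1), i j.castSucc < i j.succ
    · exact lpNorm_le_weight p x (OrderEmbedding.ofStrictMono i (Fin.strictMono_iff_lt_succ.2 h))
    · push Not at h
      obtain ⟨j, hj⟩ := h
      have hj : i j.castSucc = i j.succ := le_antisymm (hi (Fin.castSucc_lt_succ).le) hj
      refine (lpNorm_succAbove p _ j (by simp [steps, hj])).trans ?_
      have := ih (i ∘ j.castSucc.succAbove) (hi.comp (Fin.strictMono_succAbove _).monotone)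
      refine le_of_eq_of_le ?_ this
      congr 1
      funext l
      have e1 : j.castSucc.succAbove l.castSucc = (j.succAbove l).castSucc := by
        ext; simp [Fin.succAbove, Fin.lt_def]; split_ifs <;> simp
      have e2 : i (j.castSucc.succAbove l.succ) = i (j.succAbove l).succ := by
        by_cases h : (l : ℕ) + 1 = j
        · have h1 : j.castSucc.succAbove l.succ = j.succ := by
            ext; simp [Fin.succAbove, Fin.lt_def]; split_ifs <;> simp <;> omega
          have h2 : (j.succAbove l).succ = j.castSucc := by
            ext; simp [Fin.succAbove, Fin.lt_def]; split_ifs <;> simp <;> omega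
          rw [h1, h2, hj]
        · congr 1
          ext; simp [Fin.succAbove, Fin.lt_def]; split_ifs <;> simp <;> omega
      simp only [steps, Function.comp, e1, e2]

lemma weight_comp_le (p : ENNReal) {k l : ℕ} (x : Fin k → X) (f : Fin l → Fin k)
    (hf : Monotone f) : weight p (x ∘ f) ≤ weight p x := by
  refine Real.iSup_le (fun c => ?_) ?_
  · exact lpNorm_le_weight_of_monotone p x (f ∘ c.2) (hf.comp c.2.monotone)
  · exact Real.iSup_nonneg fun c => lpNorm_nonneg p _

lemma finsetWeight_mono (p : ENNReal) {σ τ : Finset X} (h : σ ⊆ τ) :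
    finsetWeight p σ ≤ finsetWeight p τ := by
  have : Nonempty (Fin τ.card ≃ τ) := ⟨τ.equivFin.symm⟩
  refine le_ciInf fun e => ?_
  classical
  let S : Finset (Fin τ.card) := Finset.univ.filter fun i => (e i : X) ∈ σ
  have hS : S.card = σ.card := by
    refine Finset.card_bij (fun i _ => (e i : X)) (fun i hi => (Finset.mem_filter.1 hi).2)
      (fun i _ j _ hij => e.injective (Subtype.ext hij)) (fun x hx => ?_)
    exact ⟨e.symm ⟨x, h hx⟩, by simp [S, hx], by simp⟩
  let f := S.orderEmbOfFin hS
  let g : Fin σ.card → σ := fun i => ⟨e (f i), (Finset.mem_filter.1 (S.orderEmbOfFin_mem hS i)).2⟩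
  have hg : Function.Bijective g := by
    rw [Fintype.bijective_iff_injective_and_card]
    refine ⟨fun i j hij => f.injective (e.injective (Subtype.ext ?_)), by simp⟩
    exact congrArg (fun z : σ => (z : X)) hij
  refine (ciInf_le (Set.finite_range _).bddBelow (Equiv.ofBijective g hg)).trans ?_
  exact weight_comp_le p (fun i => (e i : X)) f f.monotone

/-- The length `d(x₀, x₁) + ⋯ + d(xₙ₋₁, xₙ)` of a tuple. -/
def pathLength {n : ℕ} (x : Fin (n + 1) → X) : ℝ := ∑ k : Fin n, dist (x k.castSucc) (x k.succ)

lemma pathLength_comp_le {n m : ℕ} (x : Fin (n + 1) → X) (f : Fin (m + 1) → Fin (n + 1))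
    (hf : Monotone f) : pathLength (x ∘ f) ≤ pathLength x := by
  let y : ℕ → X := fun k => x (Fin.ofNat (n + 1) (min k n))
  have hy : ∀ i : Fin (n + 1), y i = x i := fun i => by
    simp only [y]
    congr 1
    ext
    simp only [Fin.val_ofNat]
    rw [min_eq_left (by omega), Nat.mod_eq_of_lt i.2]
  let s : ℕ → ℝ := fun k => ∑ i ∈ Finset.range k, dist (y i) (y (i + 1))
  have hs : ∀ a b, a ≤ b → dist (y a) (y b) ≤ s b - s a := fun a b hab => by
    have := dist_le_Ico_sum_dist y hab
    rwa [Finset.sum_Ico_eq_sub _ hab] at this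
  have hmono : Monotone s := fun a b hab => by linarith [hs a b hab, dist_nonneg (x := y a) (y := y b)]
  have htel : ∀ g : Fin (m + 1) → ℝ, ∑ k : Fin m, (g k.succ - g k.castSucc) = g (Fin.last m) - g 0 := by
    intro g
    have h1 := Fin.sum_univ_succ g
    have h2 := Fin.sum_univ_castSucc g
    rw [Finset.sum_sub_distrib]
    linarith
  have hlen : pathLength x = s n := by
    simp only [s, pathLength, ← Fin.sum_univ_eq_sum_range (fun i => dist (y i) (y (i + 1)))]
    refine Finset.sum_congr rfl fun k _ => ?_
    have h1 := hy k.castSucc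
    have h2 := hy k.succ
    simp only [Fin.val_castSucc, Fin.val_succ] at h1 h2
    rw [h1, h2]
  calc pathLength (x ∘ f)
      ≤ ∑ k : Fin m, (s (f k.succ) - s (f k.castSucc)) := by
        refine Finset.sum_le_sum fun k _ => ?_
        have := hs (f k.castSucc) (f k.succ) (hf (Fin.castSucc_lt_succ).le)
        rwa [hy, hy] at this
    _ = s (f (Fin.last m)) - s (f 0) := htel fun k => s (f k)
    _ ≤ s n := by
        have h1 : s (f (Fin.last m)) ≤ s n := hmono (by omega)
        have h2 : s 0 ≤ s (f 0) := hmono (Nat.zero_le _)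
        have h3 : s 0 = 0 := by simp [s]
        linarith
    _ = pathLength x := hlen.symm

end Weights

/-! ### Vietoris–Rips simplicial sets and complexes, and the blurred magnitude nerve -/

section VietorisRips

variable (X : Type u) [MetricSpace X]

/-- The simplicial set with `n`-simplices all tuples `(x₀, …, xₙ)`; faces delete entries and
degeneracies repeat entries. -/
def tupleSSet (X : Type u) : SSet.{u} where
  obj n := Fin (n.unop.len + 1) → X
  map f := TypeCat.ofHom fun x => x ∘ f.unop.toOrderHom

/-- The `ℓ_p`-Vietoris–Rips simplicial set: its simplices are the tuples whose `ℓ_p`-weight lies in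
the left infinite interval `L`. -/
def vrSSet (p : ENNReal) (L : LowerSet ℝ) : (tupleSSet X).Subcomplex where
  obj n := {x : Fin (n.unop.len + 1) → X | weight p x ∈ L}
  map f := fun x hx => L.lower (weight_comp_le p x _ f.unop.toOrderHom.monotone) hx

/-- The `ℓ_p`-Vietoris–Rips complex: its simplices are the finite nonempty subsets whose
`ℓ_p`-weight lies in the left infinite interval `L`. -/
def vrComplex (p : ENNReal) (L : LowerSet ℝ) : PreAbstractSimplicialComplex X where
  faces := {τ | τ.Nonempty ∧ finsetWeight p τ ∈ L}
  isRelLowerSet_faces := fun _ hτ =>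
    ⟨hτ.1, fun _ h hne => ⟨hne, L.lower (finsetWeight_mono p h) hτ.2⟩⟩

/-- The nerve of blurred magnitude homology: its simplices are the tuples `(x₀, …, xₙ)` such that
`d(x₀, x₁) + ⋯ + d(xₙ₋₁, xₙ)` lies in the left infinite interval `L`. -/
def magnitudeNerve (L : LowerSet ℝ) : (tupleSSet X).Subcomplex where
  obj n := {x : Fin (n.unop.len + 1) → X | pathLength x ∈ L}
  map f := fun x hx => L.lower (pathLength_comp_le x _ f.unop.toOrderHom.monotone) hx

lemma vrSSet_mono (p : ENNReal) : Monotone (vrSSet X p) := fun _ _ h _ _ hx => h hx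

lemma vrComplex_mono (p : ENNReal) : Monotone (vrComplex X p) := fun _ _ h _ hx => ⟨hx.1, h hx.2⟩

lemma magnitudeNerve_mono : Monotone (magnitudeNerve X) := fun _ _ h _ _ hx => h hx

/-- The intervals `(-∞, r)`. -/
def strictScale : ℝ ⥤ LowerSet ℝ :=
  Monotone.functor (f := LowerSet.Iio) fun _ _ h _ hx => lt_of_lt_of_le hx h

/-- The intervals `(-∞, r]`. -/
def nonstrictScale : ℝ ⥤ LowerSet ℝ :=
  Monotone.functor (f := LowerSet.Iic) fun _ _ h _ hx => le_trans hx h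

variable (R : Type v) [CommRing R]

/-- Simplicial homology with coefficients in `R`, as a functor on the poset of simplicial subsets
of the simplicial set of all tuples. -/
noncomputable def ssetHomology (n : ℕ) : (tupleSSet X).Subcomplex ⥤ ModuleCat.{max u v} R :=
  SSet.Subcomplex.toSSetFunctor ⋙
    SSet.homologyFunctor (ModuleCat.of R (ULift.{u} R)) n

/-- The persistent module `r ↦ Hₙ(𝓥𝓡^p_{<r} X; R)` or `r ↦ Hₙ(𝓥𝓡^p_{≤r} X; R)` of the Vietoris–Rips
simplicial sets, according to the choice of `scale` as `strictScale` or `nonstrictScale`. -/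
noncomputable def vrSSetModule (scale : ℝ ⥤ LowerSet ℝ) (p : ENNReal) (n : ℕ) :
    ℝ ⥤ ModuleCat.{max u v} R :=
  scale ⋙ (vrSSet_mono X p).functor ⋙ ssetHomology X R n

/-- The persistent module `r ↦ Hₙ(VR^p_{<r} X; R)` or `r ↦ Hₙ(VR^p_{≤r} X; R)` of the Vietoris–Rips
complexes. -/
noncomputable def vrComplexModule (scale : ℝ ⥤ LowerSet ℝ) (p : ENNReal) (n : ℕ) :
    ℝ ⥤ ModuleCat.{max u v} R :=
  scale ⋙ (vrComplex_mono X p).functor ⋙ complexHomology X R n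

/-- The persistent module `r ↦ MH_{n,<r}(X; R)` or `r ↦ MH_{n,≤r}(X; R)` of blurred magnitude
homology. -/
noncomputable def blurredMagnitudeHomology (scale : ℝ ⥤ LowerSet ℝ) (n : ℕ) :
    ℝ ⥤ ModuleCat.{max u v} R :=
  scale ⋙ (magnitudeNerve_mono X).functor ⋙ ssetHomology X R n

end VietorisRips

end LpVR

namespace LpVR

/-! ### Homology in degree `n` from partial restrictions of ambient chain maps and homotopies. -/

section Interleaving

open HomologicalComplex

variable {C : Type v} [Category.{w} C] [Preadditive C]

/-! Suppose the Gromov–Hausdorff distance is less than `η`. Choosing, in a common metric space, a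
point of the other space within `η` of each given point yields `f : X → Y` and `g : Y → X` that
increase distances by at most `δ = 2η` and whose composites move points by at most `δ`. By
Minkowski's inequality the `ℓ_p`-norm of `N` consecutive distances grows by at most `N^{1/p} δ`
under such a map. For `p < ∞` this bound grows with the degree, so it does not make `f` and `g` maps
of filtered objects up to one common shift. In degrees at most `n + 1` the shift `c = (n+2)^{1/p} δ`
suffices, however, and `Hₙ` depends on no higher degree.

The maps and homotopies are therefore built once, without scales, on ambient complexes: the chains
of the simplicial set of all tuples, or of the full simplicial complex. There `f` and `g` are chain
maps, and prisms give homotopies from their composites to the identity. `interleaved_homology` turns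
them into a `c`-interleaving as soon as the maps restrict to the filtrations in degrees at most `n +
1` with shift `c`, and the homotopies in degrees at most `n` with shift `2c`. The latter holds
because a prism simplex over `x` lies entrywise within `δ` of `x` with one entry repeated.
Repetition does not increase the weight, and moving points by `δ` changes distances by at most `2δ`.

Chains of a simplicial complex are oriented, so the prism needs an order of the vertices. An
arbitrary linear order on the whole vertex set is fixed, and `orientedPrism` is a formula compatible
with permutations of tuples. The order need not be related to the enumeration that realises the
weight of a simplex: only the vertex set of a prism simplex matters, and it is enumerated again
starting from the minimising enumeration of the original simplex. -/

lemma down_prev_le (n : ℕ) : (ComplexShape.down ℕ).prev n ≤ n + 1 := by simp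

lemma down_next_le (n : ℕ) : (ComplexShape.down ℕ).next n ≤ n := by
  cases n <;> simp

/-- A morphism between ambient chain complexes that restricts to subcomplexes in degrees at most
`n + 1` restricts to the short complexes that compute the homology in degree `n`. -/
lemma exists_sc_lift {K L E F : ChainComplex C ℕ} (i : K ⟶ E) (j : L ⟶ F)
    (hj : ∀ m, Mono (j.f m)) (α : E ⟶ F) (n : ℕ)
    (h : ∀ m ≤ n + 1, ∃ φ : K.X m ⟶ L.X m, φ ≫ j.f m = i.f m ≫ α.f m) :
    ∃ φ : K.sc n ⟶ L.sc n, φ ≫ (shortComplexFunctor C _ n).map j =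
      (shortComplexFunctor C _ n).map (i ≫ α) := by
  obtain ⟨φ₁, h₁⟩ := h _ (down_prev_le n)
  obtain ⟨φ₂, h₂⟩ := h n (Nat.le_succ n)
  obtain ⟨φ₃, h₃⟩ := h _ ((down_next_le n).trans (Nat.le_succ n))
  have c₁ : φ₁ ≫ L.d _ n = K.d _ n ≫ φ₂ := by
    rw [← cancel_mono (j.f n), Category.assoc, Category.assoc, h₂, ← j.comm, ← Category.assoc, h₁]
    simp
  have c₂ : φ₂ ≫ L.d n _ = K.d n _ ≫ φ₃ := by
    rw [← cancel_mono (j.f _), Category.assoc, Category.assoc, h₃, ← j.comm, ← Category.assoc, h₂]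
    simp
  refine ⟨⟨φ₁, φ₂, φ₃, c₁, c₂⟩, ?_⟩
  ext
  · exact h₁
  · exact h₂
  · exact h₃

lemma sc_hom_ext {L F : ChainComplex C ℕ} (j : L ⟶ F) (hj : ∀ m, Mono (j.f m)) (n : ℕ)
    {S : ShortComplex C} {φ ψ : S ⟶ L.sc n}
    (h : φ ≫ (shortComplexFunctor C _ n).map j = ψ ≫ (shortComplexFunctor C _ n).map j) :
    φ = ψ := by
  ext
  · exact (cancel_mono (j.f _)).1 (congrArg ShortComplex.Hom.τ₁ h)
  · exact (cancel_mono (j.f _)).1 (congrArg ShortComplex.Hom.τ₂ h)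
  · exact (cancel_mono (j.f _)).1 (congrArg ShortComplex.Hom.τ₃ h)

variable [CategoryWithHomology C]

/-- Two morphisms of short complexes induced by homotopic endomorphisms of an ambient chain complex
agree in homology if the homotopy restricts in degrees at most `n`. -/
lemma sc_homologyMap_eq {K L E F : ChainComplex C ℕ} (i : K ⟶ E) (j : L ⟶ F)
    (hj : ∀ m, Mono (j.f m)) {α β : E ⟶ F} (H : Homotopy α β) (n : ℕ)
    (h : ∀ k ≤ n, ∀ l, ∃ φ : K.X k ⟶ L.X l, φ ≫ j.f l = i.f k ≫ H.hom k l)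
    (φ ψ : K.sc n ⟶ L.sc n)
    (hφ : φ ≫ (shortComplexFunctor C _ n).map j = (shortComplexFunctor C _ n).map (i ≫ α))
    (hψ : ψ ≫ (shortComplexFunctor C _ n).map j = (shortComplexFunctor C _ n).map (i ≫ β)) :
    ShortComplex.homologyMap φ = ShortComplex.homologyMap ψ := by
  obtain ⟨h₁, e₁⟩ := h n le_rfl ((ComplexShape.down ℕ).prev n)
  obtain ⟨h₂, e₂⟩ := h _ (down_next_le n) n
  let φ₂ : K.X n ⟶ L.X n := φ.τ₂
  let ψ₂ : K.X n ⟶ L.X n := ψ.τ₂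
  have hφ₂ : φ₂ ≫ j.f n = i.f n ≫ α.f n := congrArg ShortComplex.Hom.τ₂ hφ
  have hψ₂ : ψ₂ ≫ j.f n = i.f n ≫ β.f n := congrArg ShortComplex.Hom.τ₂ hψ
  have key : φ₂ = K.d n _ ≫ h₂ + h₁ ≫ L.d _ n + ψ₂ := by
    rw [← cancel_mono (j.f n), hφ₂, Preadditive.add_comp, hψ₂, Preadditive.add_comp,
      Category.assoc, Category.assoc, e₂,
      ← j.comm, ← Category.assoc h₁, e₁, H.comm n, ← Category.assoc (K.d _ _), ← i.comm]
    simp only [Preadditive.comp_add, Category.assoc]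
    rfl
  let H₁ : (K.sc n).X₂ ⟶ (L.sc n).X₁ := h₁
  let H₂ : (K.sc n).X₃ ⟶ (L.sc n).X₂ := h₂
  have key : φ.τ₂ = (K.sc n).g ≫ H₂ + H₁ ≫ (L.sc n).f + ψ.τ₂ := key
  -- Only the middle identity has content. The outer components are defined as the differences that
  -- make the outer identities true, and the middle one forces `h₀` to compose to zero with the
  -- incoming differential and `h₃` with the outgoing one. This is why no homotopy is needed in
  -- degree `n + 1`.
  refine ShortComplex.Homotopy.homologyMap_congr
    { h₀ := φ.τ₁ - (K.sc n).f ≫ H₁ - ψ.τ₁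
      h₀_f := ?_
      h₁ := H₁
      h₂ := H₂
      h₃ := φ.τ₃ - H₂ ≫ (L.sc n).g - ψ.τ₃
      g_h₃ := ?_
      comm₁ := by abel
      comm₂ := key
      comm₃ := by abel }
  · simp only [Preadditive.sub_comp, Category.assoc, φ.comm₁₂, ψ.comm₁₂, key, Preadditive.comp_add,
      ShortComplex.zero_assoc, Limits.zero_comp]
    abel
  · simp only [Preadditive.comp_sub, ← φ.comm₂₃, ← ψ.comm₂₃, key, Preadditive.add_comp,
      Category.assoc, ShortComplex.zero, Limits.comp_zero]
    abel

/-- Restrictions of one ambient map along monomorphisms are unique, so they commute with the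
inclusions between subcomplexes. -/
lemma sc_homologyMap_naturality {K K' L L' E F : ChainComplex C ℕ} (i : K ⟶ E) (i' : K' ⟶ E)
    (j : L ⟶ F) (j' : L' ⟶ F) (hj : ∀ m, Mono (j'.f m)) (a : K ⟶ K') (b : L ⟶ L')
    (ha : a ≫ i' = i) (hb : b ≫ j' = j) (α : E ⟶ F) (n : ℕ)
    (φ : K.sc n ⟶ L.sc n) (φ' : K'.sc n ⟶ L'.sc n)
    (hφ : φ ≫ (shortComplexFunctor C _ n).map j = (shortComplexFunctor C _ n).map (i ≫ α))
    (hφ' : φ' ≫ (shortComplexFunctor C _ n).map j' = (shortComplexFunctor C _ n).map (i' ≫ α)) :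
    homologyMap a n ≫ ShortComplex.homologyMap φ' =
      ShortComplex.homologyMap φ ≫ homologyMap b n := by
  have : (shortComplexFunctor C _ n).map a ≫ φ' = φ ≫ (shortComplexFunctor C _ n).map b := by
    refine sc_hom_ext _ hj n ?_
    rw [Category.assoc, Category.assoc, hφ', ← Functor.map_comp, ← Functor.map_comp, hb, hφ,
      ← Category.assoc a, ha]
  let A : K.sc n ⟶ K'.sc n := (shortComplexFunctor C _ n).map a
  let B : L.sc n ⟶ L'.sc n := (shortComplexFunctor C _ n).map b
  have e : ShortComplex.homologyMap (A ≫ φ') = ShortComplex.homologyMap (φ ≫ B) :=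
    congrArg (fun t => ShortComplex.homologyMap t) this
  rw [ShortComplex.homologyMap_comp A φ', ShortComplex.homologyMap_comp φ B] at e
  exact e

/-- The composite of the restrictions restricts `α ≫ β`, while the inclusion `a` restricts the
identity; the ambient homotopy identifies the two in homology. -/
lemma sc_homologyMap_comp_eq {K L K' E F : ChainComplex C ℕ} (i : K ⟶ E) (j : L ⟶ F)
    (i' : K' ⟶ E) (hi : ∀ m, Mono (i'.f m)) (a : K ⟶ K') (ha : a ≫ i' = i)
    (α : E ⟶ F) (β : F ⟶ E) (H : Homotopy (α ≫ β) (𝟙 E)) (n : ℕ)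
    (φ : K.sc n ⟶ L.sc n) (ψ : L.sc n ⟶ K'.sc n)
    (hφ : φ ≫ (shortComplexFunctor C _ n).map j = (shortComplexFunctor C _ n).map (i ≫ α))
    (hψ : ψ ≫ (shortComplexFunctor C _ n).map i' = (shortComplexFunctor C _ n).map (j ≫ β))
    (h : ∀ k ≤ n, ∃ φ : K.X k ⟶ K'.X (k + 1), φ ≫ i'.f (k + 1) = i.f k ≫ H.hom k (k + 1)) :
    ShortComplex.homologyMap φ ≫ ShortComplex.homologyMap ψ = homologyMap a n := by
  rw [← ShortComplex.homologyMap_comp]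
  refine sc_homologyMap_eq i i' hi H n (fun k hk l => ?_) _ _ ?_ ?_
  -- Off the pairs `(k, k + 1)` the homotopy vanishes and `0` is a lift. This includes the pair `(0,
  -- 0)` that occurs for `n = 0`, where `next 0 = 0`.
  · by_cases hl : k + 1 = l
    · subst hl
      exact h k hk
    · exact ⟨0, by rw [H.zero k l hl]; simp⟩
  · rw [Category.assoc, hψ, Functor.map_comp, ← Category.assoc, hφ, ← Functor.map_comp,
      Category.assoc]
  · rw [← Functor.map_comp, ha, Category.comp_id]

/-- Persistent chain complexes embedded in homotopy equivalent ambient complexes have interleaved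
homology if the homotopy equivalence restricts in the relevant degrees, up to a shift. -/
theorem interleaved_homology {P Q : ℝ ⥤ ChainComplex C ℕ} {E F : ChainComplex C ℕ}
    (i : P ⟶ (Functor.const ℝ).obj E) (j : Q ⟶ (Functor.const ℝ).obj F)
    (hi : ∀ r m, Mono ((i.app r).f m)) (hj : ∀ r m, Mono ((j.app r).f m))
    (α : E ⟶ F) (β : F ⟶ E) (HE : Homotopy (α ≫ β) (𝟙 E)) (HF : Homotopy (β ≫ α) (𝟙 F))
    (n : ℕ) (c : ℝ) (hc : 0 ≤ c)
    (hα : ∀ r, ∀ m ≤ n + 1, ∃ φ : (P.obj r).X m ⟶ (Q.obj (r + c)).X m,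
      φ ≫ (j.app (r + c)).f m = (i.app r).f m ≫ α.f m)
    (hβ : ∀ r, ∀ m ≤ n + 1, ∃ φ : (Q.obj r).X m ⟶ (P.obj (r + c)).X m,
      φ ≫ (i.app (r + c)).f m = (j.app r).f m ≫ β.f m)
    (hHE : ∀ r, ∀ k ≤ n, ∃ φ : (P.obj r).X k ⟶ (P.obj (r + c + c)).X (k + 1),
      φ ≫ (i.app (r + c + c)).f (k + 1) = (i.app r).f k ≫ HE.hom k (k + 1))
    (hHF : ∀ r, ∀ k ≤ n, ∃ φ : (Q.obj r).X k ⟶ (Q.obj (r + c + c)).X (k + 1),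
      φ ≫ (j.app (r + c + c)).f (k + 1) = (j.app r).f k ≫ HF.hom k (k + 1)) :
    Interleaved c hc (P ⋙ homologyFunctor C _ n) (Q ⋙ homologyFunctor C _ n) := by
  have nat_i : ∀ {r s : ℝ} (f : r ⟶ s), P.map f ≫ i.app s = i.app r := fun f => by
    simp
  have nat_j : ∀ {r s : ℝ} (f : r ⟶ s), Q.map f ≫ j.app s = j.app r := fun f => by
    simp
  choose φ hφ using fun r => exists_sc_lift (i.app r) (j.app (r + c)) (hj _) α n (hα r)
  choose ψ hψ using fun r => exists_sc_lift (j.app r) (i.app (r + c)) (hi _) β n (hβ r)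
  refine ⟨⟨fun r => ShortComplex.homologyMap (φ r), fun r s f => ?_⟩,
    ⟨fun r => ShortComplex.homologyMap (ψ r), fun r s f => ?_⟩, ?_, ?_⟩
  · exact sc_homologyMap_naturality (i.app r) (i.app s) (j.app (r + c)) (j.app (s + c)) (hj _)
      (P.map f) (Q.map ((shift c).map f)) (nat_i _) (nat_j _) α n _ _ (hφ r) (hφ s)
  · exact sc_homologyMap_naturality (j.app r) (j.app s) (i.app (r + c)) (i.app (s + c)) (hi _)
      (Q.map f) (P.map ((shift c).map f)) (nat_j _) (nat_i _) β n _ _ (hψ r) (hψ s)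
  · ext1
    funext r
    exact sc_homologyMap_comp_eq (i.app r) (j.app (r + c)) (i.app (r + c + c)) (hi _)
      (P.map (homOfLE _)) (nat_i _) α β HE n _ _ (hφ r) (hψ (r + c)) (hHE r)
  · ext1
    funext r
    exact sc_homologyMap_comp_eq (j.app r) (i.app (r + c)) (j.app (r + c + c)) (hj _)
      (Q.map (homOfLE _)) (nat_j _) β α HF n _ _ (hψ r) (hφ (r + c)) (hHF r)

end Interleaving

/-! ### From the Gromov–Hausdorff distance to almost inverse maps, and the passage to the infimum.
-/

section Distances

/-- Maps in both directions that increase distances by at most `δ` and whose composites move points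
by at most `δ`. -/
structure AlmostInverse {X Y : Type u} [MetricSpace X] [MetricSpace Y] (f : X → Y) (g : Y → X)
    (δ : ℝ) : Prop where
  nonneg : 0 ≤ δ
  dist_map_le : ∀ x x', dist (f x) (f x') ≤ dist x x' + δ
  dist_inv_le : ∀ y y', dist (g y) (g y') ≤ dist y y' + δ
  dist_left_le : ∀ x, dist ((g ∘ f) x) x ≤ δ
  dist_right_le : ∀ y, dist ((f ∘ g) y) y ≤ δ

/-- Each point is sent to some point of the other space at distance less than `η` in `Z`. The strict
inequality supplies such points without compactness, and every estimate uses two jumps of length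
less than `η`. -/
lemma exists_almostInverse_of_ghEDist_lt {X Y : Type u} [MetricSpace X] [MetricSpace Y] {η : ℝ}
    (hη : 0 < η) (h : ghEDist X Y < ENNReal.ofReal η) :
    ∃ (f : X → Y) (g : Y → X), AlmostInverse f g (2 * η) := by
  simp only [ghEDist, iInf_lt_iff] at h
  obtain ⟨Z, _, i, hi, j, hj, h⟩ := h
  have h1 : ∀ x, ∃ y, dist (i x) (j y) < η := fun x => by
    obtain ⟨_, ⟨y, rfl⟩, hy⟩ := Metric.exists_edist_lt_of_hausdorffEDist_lt (Set.mem_range_self x) h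
    exact ⟨y, by rwa [edist_dist, ENNReal.ofReal_lt_ofReal_iff hη] at hy⟩
  have h2 : ∀ y, ∃ x, dist (j y) (i x) < η := fun y => by
    rw [Metric.hausdorffEDist_comm] at h
    obtain ⟨_, ⟨x, rfl⟩, hx⟩ := Metric.exists_edist_lt_of_hausdorffEDist_lt (Set.mem_range_self y) h
    exact ⟨x, by rwa [edist_dist, ENNReal.ofReal_lt_ofReal_iff hη] at hx⟩
  choose f hf using h1
  choose g hg using h2
  refine ⟨f, g, by positivity, fun x x' => ?_, fun y y' => ?_, fun x => ?_, fun y => ?_⟩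
  · rw [← hj.dist_eq, ← hi.dist_eq]
    have := dist_triangle4 (j (f x)) (i x) (i x') (j (f x'))
    rw [dist_comm (j (f x)) (i x)] at this
    linarith [hf x, hf x']
  · rw [← hj.dist_eq, ← hi.dist_eq]
    have := dist_triangle4 (i (g y)) (j y) (j y') (i (g y'))
    rw [dist_comm (i (g y)) (j y)] at this
    linarith [hg y, hg y']
  · rw [← hi.dist_eq, dist_comm, Function.comp]
    linarith [dist_triangle (i x) (j (f x)) (i (g (f x))), hf x, hg (f x)]
  · rw [← hj.dist_eq, dist_comm, Function.comp]
    linarith [dist_triangle (j y) (i (g y)) (j (f (g y))), hg y, hf (g y)]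

/-- The bound is tested against every `b` above the right-hand side; an infinite `ghEDist` leaves no
such `b`. -/
lemma interleavingDist_le_mul_ghEDist {X Y : Type u} [MetricSpace X] [MetricSpace Y]
    {C : Type v} [Category.{w} C] (P Q : ℝ ⥤ C) (k : ℝ) (hk : 0 < k) (K : ENNReal)
    (hK : ENNReal.ofReal k = K)
    (h : ∀ (η : ℝ) (hη : 0 < η), ghEDist X Y < ENNReal.ofReal η →
      Interleaved (k * (2 * η)) (by positivity) P Q) :
    interleavingDist P Q ≤ 2 * K * ghEDist X Y := by
  subst hK
  refine le_of_forall_gt_imp_ge_of_dense fun b hb => ?_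
  rcases eq_or_ne b ⊤ with rfl | hbt
  · exact le_top
  lift b to NNReal using hbt
  have h0 : 2 * ENNReal.ofReal k ≠ 0 := by simp [hk]
  have ht : 2 * ENNReal.ofReal k ≠ ⊤ := ENNReal.mul_ne_top (by simp) (by simp)
  -- With `η = b / (2k)` the interleaving parameter `k * (2 * η)` is exactly `b`.
  have hlt : ghEDist X Y < ENNReal.ofReal ((b : ℝ) / (2 * k)) := by
    rw [ENNReal.ofReal_div_of_pos (by positivity), ENNReal.ofReal_mul (by norm_num),
      ENNReal.lt_div_iff_mul_lt (Or.inl (by simpa using h0)) (Or.inl (by simpa using ht)), mul_comm]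
    simpa using hb
  have hb0 : 0 < (b : ℝ) / (2 * k) := ENNReal.ofReal_pos.1 (bot_le.trans_lt hlt)
  calc interleavingDist P Q ≤ ENNReal.ofReal (k * (2 * ((b : ℝ) / (2 * k)))) :=
        iInf_le_of_le _ (iInf₂_le (by linarith [mul_pos hk hb0]) (h _ hb0 hlt))
    _ = b := by
        rw [show k * (2 * ((b : ℝ) / (2 * k))) = b by field_simp]
        simp

end Distances

/-! ### How weights and path lengths change under small perturbations of distances. -/

section WeightEstimates

variable {X Y : Type u} [MetricSpace X] [MetricSpace Y] {p : ENNReal}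

/-- Monotonicity of the norm in the absolute values of the entries, then Minkowski; the constant
vector `δ` has norm `m^{1/p} δ`, read as `δ` (or `0` when `m = 0`) for `p = ∞`. -/
lemma lpNorm_le_add (hp : 1 ≤ p) {m : ℕ} {a b : Fin m → ℝ} {δ : ℝ} (hδ : 0 ≤ δ)
    (ha : ∀ i, 0 ≤ a i) (hab : ∀ i, a i ≤ b i + δ) :
    lpNorm p a ≤ lpNorm p b + (m : ℝ) ^ (1 / p).toReal * δ := by
  have : Fact (1 ≤ p) := ⟨hp⟩
  have h1 : lpNorm p a ≤ ‖WithLp.toLp p b + WithLp.toLp p (Function.const (Fin m) δ)‖ := by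
    have hle : ∀ i, ‖a i‖ ≤ ‖b i + δ‖ := fun i => by
      rw [Real.norm_of_nonneg (ha i)]
      exact (hab i).trans (le_abs_self _)
    rcases eq_or_ne p ⊤ with rfl | ht
    · simp only [lpNorm, PiLp.norm_eq_ciSup]
      exact ciSup_mono (Set.finite_range _).bddAbove hle
    · have hp0 : 0 < p.toReal := ENNReal.toReal_pos (by positivity) ht
      simp only [lpNorm, PiLp.norm_eq_sum hp0]
      gcongr with i
      exact hle i
  refine h1.trans ((norm_add_le _ _).trans ?_)
  have h2 : ‖WithLp.toLp p (Function.const (Fin m) δ)‖ ≤ (m : ℝ) ^ (1 / p).toReal * δ := by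
    rcases eq_or_ne p ⊤ with rfl | ht
    · simp only [PiLp.norm_eq_ciSup]
      refine Real.iSup_le (fun i => ?_) (by positivity)
      simp [abs_of_nonneg hδ]
    · rw [PiLp.norm_toLp_const ht]
      simp [abs_of_nonneg hδ]
  exact add_le_add le_rfl h2

/-- An increasing sequence of positions in a `k`-tuple has at most `k - 1 ≤ N` steps, so the
previous estimate applies uniformly to all of them. -/
lemma weight_le_add (hp : 1 ≤ p) {k N : ℕ} (hk : k ≤ N + 1) {x : Fin k → X} {y : Fin k → Y}
    {δ : ℝ} (hδ : 0 ≤ δ) (h : ∀ i j, dist (y i) (y j) ≤ dist (x i) (x j) + δ) :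
    weight p y ≤ weight p x + (N : ℝ) ^ (1 / p).toReal * δ := by
  have h0 : 0 ≤ weight p x := Real.iSup_nonneg fun c => lpNorm_nonneg p _
  refine Real.iSup_le (fun c => ?_) (by positivity)
  refine (lpNorm_le_add hp (b := steps (x ∘ c.2)) hδ (fun _ => dist_nonneg)
    (fun _ => h _ _)).trans ?_
  have hm : (c.1 : ℕ) ≤ N := by omega
  gcongr
  exact lpNorm_le_weight p x c.2

lemma pathLength_le_add {m N : ℕ} (hm : m ≤ N) {x : Fin (m + 1) → X} {y : Fin (m + 1) → Y}
    {δ : ℝ} (hδ : 0 ≤ δ) (h : ∀ i j, dist (y i) (y j) ≤ dist (x i) (x j) + δ) :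
    pathLength y ≤ pathLength x + N * δ := by
  calc pathLength y ≤ ∑ k : Fin m, (dist (x k.castSucc) (x k.succ) + δ) :=
        Finset.sum_le_sum fun k _ => h _ _
    _ = pathLength x + m * δ := by simp [Finset.sum_add_distrib, pathLength]
    _ ≤ _ := by gcongr

lemma dist_le_add_of_dist_le {ι : Type*} {x y : ι → X} {δ : ℝ} (h : ∀ i, dist (y i) (x i) ≤ δ)
    (i j : ι) : dist (y i) (y j) ≤ dist (x i) (x j) + 2 * δ := by
  have := dist_triangle4 (y i) (x i) (x j) (y j)
  rw [dist_comm (x j)] at this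
  linarith [h i, h j]

/-- The weight of a finite set is at most the weight of a tuple that enumerates it, possibly with
repetitions. -/
lemma finsetWeight_le_weight (p : ENNReal) {k : ℕ} (x : Fin k → X) (τ : Finset X)
    (h : ∀ a, a ∈ τ ↔ ∃ i, x i = a) : finsetWeight p τ ≤ weight p x := by
  classical
  -- One position is kept for each element of `τ`. Read in increasing order, these positions give a
  -- repetition-free enumeration that is a subsequence of `x`.
  choose s hs using fun a : τ => (h a).1 a.2
  have hs_inj : Function.Injective s := fun a b hab => Subtype.ext (by rw [← hs a, ← hs b, hab])
  let S : Finset (Fin k) := Finset.univ.image s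
  have hS : S.card = τ.card := by simp [S, Finset.card_image_of_injective _ hs_inj]
  let f := S.orderEmbOfFin hS
  let g : Fin τ.card → τ := fun i => ⟨x (f i), (h _).2 ⟨_, rfl⟩⟩
  have hg : Function.Bijective g := by
    rw [Fintype.bijective_iff_injective_and_card]
    refine ⟨fun i j hij => f.injective ?_, by simp⟩
    obtain ⟨a, -, ha⟩ := Finset.mem_image.1 (S.orderEmbOfFin_mem hS i)
    obtain ⟨b, -, hb⟩ := Finset.mem_image.1 (S.orderEmbOfFin_mem hS j)
    have hij : x (f i) = x (f j) := congrArg Subtype.val hij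
    change s a = f i at ha
    change s b = f j at hb
    rw [← ha, ← hb] at hij ⊢
    rw [hs, hs] at hij
    rw [Subtype.ext hij]
  refine (ciInf_le (Set.finite_range _).bddBelow (Equiv.ofBijective g hg)).trans ?_
  exact weight_comp_le p x f f.monotone

lemma exists_weight_eq_finsetWeight (p : ENNReal) (τ : Finset X) :
    ∃ e : Fin τ.card ≃ τ, weight p (fun i => (e i : X)) = finsetWeight p τ := by
  have : Nonempty (Fin τ.card ≃ τ) := ⟨τ.equivFin.symm⟩
  exact exists_eq_ciInf_of_finite

end WeightEstimates

/-! ### The prism homotopy on the simplicial set of all tuples. -/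

section TupleSSet

open Simplicial Opposite

variable {X Y : Type u}

/-- The map of simplicial sets of tuples induced by a map of sets. -/
def tupleSSetMap (f : X → Y) : tupleSSet X ⟶ tupleSSet Y where
  app _ := TypeCat.ofHom fun x => f ∘ x

/-- The tuple `(f x₀, …, f xᵢ, g xᵢ, …, g xₘ)`. -/
def prism (f g : X → Y) {m : ℕ} (i : Fin (m + 1)) (x : Fin (m + 1) → X) : Fin (m + 2) → Y :=
  fun k => if k ≤ i.castSucc then f (x (i.predAbove k)) else g (x (i.predAbove k))

/-- The index `a` enters through its numerical value, so that the simplicial identities below become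
arithmetic of natural numbers. -/
lemma prism_of_le (f g : X → Y) {m : ℕ} {i : Fin (m + 1)} (x : Fin (m + 1) → X) {k : Fin (m + 2)}
    {a : Fin (m + 1)} (hk : (k : ℕ) ≤ i) (ha : (a : ℕ) = k) : prism f g i x k = f (x a) := by
  have h : k ≤ i.castSucc := hk
  rw [prism, if_pos h, Fin.predAbove_of_le_castSucc _ _ h]
  congr 2
  exact Fin.ext ha.symm

lemma prism_of_lt (f g : X → Y) {m : ℕ} {i : Fin (m + 1)} (x : Fin (m + 1) → X) {k : Fin (m + 2)}
    {a : Fin (m + 1)} (hk : (i : ℕ) < k) (ha : (a : ℕ) + 1 = k) : prism f g i x k = g (x a) := by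
  have h : ¬ k ≤ i.castSucc := by
    simp only [Fin.le_def, Fin.val_castSucc]; omega
  rw [prism, if_neg h, Fin.predAbove_of_castSucc_lt _ _ (not_le.1 h)]
  congr 2
  ext
  simp only [Fin.val_pred]
  omega

lemma prism_apply (f g : X → Y) {m : ℕ} (i : Fin (m + 1)) (x : Fin (m + 1) → X) (k : Fin (m + 2)) :
    ∃ a : Fin (m + 1), ((k : ℕ) ≤ i ∧ (a : ℕ) = k ∧ prism f g i x k = f (x a)) ∨
      ((i : ℕ) < k ∧ (a : ℕ) + 1 = k ∧ prism f g i x k = g (x a)) := by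
  rcases le_or_gt (k : ℕ) i with h | h
  · exact ⟨⟨k, by omega⟩, Or.inl ⟨h, rfl, prism_of_le f g x h rfl⟩⟩
  · exact ⟨⟨k - 1, by omega⟩, Or.inr ⟨h, by simp; omega, prism_of_lt f g x h (by simp; omega)⟩⟩

lemma succAbove_val {m : ℕ} (i : Fin (m + 1)) (k : Fin m) :
    (i.succAbove k : ℕ) = if (k : ℕ) < i then (k : ℕ) else k + 1 := by
  simp only [Fin.succAbove, Fin.lt_def, Fin.val_castSucc]
  split_ifs <;> rfl

lemma predAbove_val {m : ℕ} (i : Fin m) (k : Fin (m + 1)) :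
    (i.predAbove k : ℕ) = if (i : ℕ) < k then (k : ℕ) - 1 else k := by
  simp only [Fin.predAbove, Fin.lt_def, Fin.val_castSucc]
  split_ifs <;> simp

/-- Two prisms reindexed by maps of positions agree if the positions and indices agree. -/
lemma prism_comp_eq (f g : X → Y) {m l n : ℕ} {i : Fin (m + 1)} {j : Fin (l + 1)}
    {x : Fin (m + 1) → X} {y : Fin (l + 1) → X} {s : Fin n → Fin (m + 2)} {t : Fin n → Fin (l + 2)}
    (h₁ : ∀ k, (s k : ℕ) ≤ i ↔ (t k : ℕ) ≤ j)
    (h₂ : ∀ k (a : Fin (m + 1)) (b : Fin (l + 1)), (s k : ℕ) ≤ i → (a : ℕ) = s k → (b : ℕ) = t k →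
      x a = y b)
    (h₃ : ∀ k (a : Fin (m + 1)) (b : Fin (l + 1)), (i : ℕ) < s k → (a : ℕ) + 1 = s k →
      (b : ℕ) + 1 = t k → x a = y b) :
    prism f g i x ∘ s = prism f g j y ∘ t := by
  funext k
  obtain ⟨a, ⟨h, ha, e⟩ | ⟨h, ha, e⟩⟩ := prism_apply f g i x (s k) <;>
  obtain ⟨b, ⟨h', hb, e'⟩ | ⟨h', hb, e'⟩⟩ := prism_apply f g j y (t k)
  · simp only [Function.comp, e, e', h₂ k a b h ha hb]
  · have := h₁ k; omega
  · have := h₁ k; omega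
  · simp only [Function.comp, e, e', h₃ k a b h ha hb]

/-- Any two maps to a set induce homotopic maps of simplicial sets of tuples. -/
def prismHomotopy (f g : X → Y) :
    SimplicialObject.Homotopy (tupleSSetMap f) (tupleSSetMap g) where
  h i := TypeCat.ofHom (prism f g i)
  h_zero_comp_δ_zero n := by
    ext x
    refine funext fun k => ?_
    exact prism_of_lt f g x (i := 0) (k := Fin.succ (n := n + 1) k) (a := k) (Nat.succ_pos _) rfl
  h_last_comp_δ_last n := by
    ext x
    refine funext fun (k : Fin (n + 1)) => ?_
    have h : ((Fin.last (n + 1)).succAbove k : ℕ) = k := by simp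
    exact prism_of_le f g x (i := Fin.last n) (k := (Fin.last (n + 1)).succAbove k) (a := k)
      (by rw [h, Fin.val_last]; omega) h.symm
  -- In this and the remaining identities, both sides are prisms precomposed with maps of positions.
  -- It suffices that each entry gets the same one of `f` and `g`, applied to the same point.
  h_succ_comp_δ_castSucc_of_lt i j hij := by
    ext x
    refine prism_comp_eq f g (s := i.castSucc.succAbove) (t := id) (y := x ∘ i.succAbove) ?_ ?_ ?_
    · intro k
      simp only [id, succAbove_val, Fin.val_castSucc, Fin.val_succ, Fin.le_def] at hij ⊢
      split_ifs <;> omega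
    all_goals
      intro k a b h ha hb
      simp only [id, succAbove_val, Fin.val_castSucc, Fin.val_succ, Fin.le_def] at hij h ha hb
      refine congrArg x (Fin.ext ?_)
      simp only [succAbove_val]
      split_ifs at * <;> omega
  h_succ_comp_δ_castSucc_succ j := by
    ext x
    refine prism_comp_eq f g (s := j.castSucc.succ.succAbove) (t := j.castSucc.succ.succAbove)
      (y := x) ?_ ?_ ?_
    · intro k
      simp only [succAbove_val, Fin.val_castSucc, Fin.val_succ]
      split_ifs <;> omega
    all_goals
      intro k a b h ha hb
      simp only [succAbove_val, Fin.val_castSucc, Fin.val_succ] at h ha hb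
      refine congrArg x (Fin.ext ?_)
      split_ifs at * <;> omega
  h_castSucc_comp_δ_succ_of_lt i j hji := by
    ext x
    refine prism_comp_eq f g (s := i.succ.succAbove) (t := id) (y := x ∘ i.succAbove) ?_ ?_ ?_
    · intro k
      simp only [id, succAbove_val, Fin.val_castSucc, Fin.val_succ, Fin.lt_def] at hji ⊢
      split_ifs <;> omega
    all_goals
      intro k a b h ha hb
      simp only [id, succAbove_val, Fin.val_castSucc, Fin.val_succ, Fin.lt_def] at hji h ha hb
      refine congrArg x (Fin.ext ?_)
      simp only [succAbove_val]
      split_ifs at * <;> omega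
  h_comp_σ_castSucc_of_le i j hij := by
    ext x
    refine prism_comp_eq f g (s := i.castSucc.predAbove) (t := id) (y := x ∘ i.predAbove) ?_ ?_ ?_
    · intro k
      simp only [id, predAbove_val, Fin.val_castSucc, Fin.val_succ, Fin.le_def] at hij ⊢
      split_ifs <;> omega
    all_goals
      intro k a b h ha hb
      simp only [id, predAbove_val, Fin.val_castSucc, Fin.le_def] at hij h ha hb
      refine congrArg x (Fin.ext ?_)
      simp only [predAbove_val]
      split_ifs at * <;> omega
  h_comp_σ_succ_of_lt i j hji := by
    ext x
    refine prism_comp_eq f g (s := i.succ.predAbove) (t := id) (y := x ∘ i.predAbove) ?_ ?_ ?_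
    · intro k
      simp only [id, predAbove_val, Fin.val_castSucc, Fin.val_succ, Fin.le_def] at hji ⊢
      split_ifs <;> omega
    all_goals
      intro k a b h ha hb
      simp only [id, predAbove_val, Fin.val_succ, Fin.le_def] at hji h ha hb
      refine congrArg x (Fin.ext ?_)
      simp only [predAbove_val]
      split_ifs at * <;> omega

end TupleSSet

/-! ### Chains of simplicial subsets, and lifting maps and prisms to them. -/

section SubcomplexChains

open Simplicial Opposite Limits

variable {C : Type v} [Category.{w} C] [Preadditive C] [HasCoproducts.{u} C] (R : C)

/-- The map out of a chain group with prescribed values on simplices. -/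
noncomputable def chainDesc {S : SSet.{u}} {m : ℕ} {T : C} (φ : S _⦋m⦌ → (R ⟶ T)) :
    (S.chainComplex R).X m ⟶ T :=
  (S.isColimitChainComplexXCofan R m).desc (Limits.Cofan.mk T φ)

lemma ι_chainDesc {S : SSet.{u}} {m : ℕ} {T : C} (φ : S _⦋m⦌ → (R ⟶ T)) (x : S _⦋m⦌) :
    S.ιChainComplex x ≫ chainDesc R φ = φ x :=
  (S.isColimitChainComplexXCofan R m).fac (Limits.Cofan.mk T φ) (Discrete.mk x)

/-- The summand of the chain group of a simplicial subset corresponding to a simplex. -/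
noncomputable def subcomplexι {S : SSet.{u}} (A : S.Subcomplex) {m : ℕ} (x : S _⦋m⦌)
    (hx : x ∈ A.obj (op ⦋m⦌)) : R ⟶ ((A : SSet).chainComplex R).X m :=
  SSet.ιChainComplex (A : SSet) (n := m) ⟨x, hx⟩

lemma subcomplexι_comp {S : SSet.{u}} (A : S.Subcomplex) {m : ℕ} (x : S _⦋m⦌)
    (hx : x ∈ A.obj (op ⦋m⦌)) :
    subcomplexι R A x hx ≫ (SSet.chainComplexMap A.ι R).f m = S.ιChainComplex x :=
  SSet.ι_chainComplexMap_f _ _ _ R _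

lemma subcomplexChain_hom_ext {S : SSet.{u}} (A : S.Subcomplex) {m : ℕ} {T : C}
    {φ ψ : ((A : SSet).chainComplex R).X m ⟶ T}
    (h : ∀ x hx, subcomplexι R A x hx ≫ φ = subcomplexι R A x hx ≫ ψ) : φ = ψ :=
  SSet.chainComplex_hom_ext fun x => h x.1 x.2

/-- In each degree, sending the simplices outside `A` to zero is a retraction. It need not commute
with the differentials, and it need not, since the claim is degreewise. -/
lemma mono_chainComplexMap_ι {S : SSet.{u}} (A : S.Subcomplex) (m : ℕ) :
    Mono ((SSet.chainComplexMap A.ι R).f m) := by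
  classical
  let ρ : (S.chainComplex R).X m ⟶ ((A : SSet).chainComplex R).X m :=
    chainDesc R fun x => if h : x ∈ A.obj (op ⦋m⦌) then subcomplexι R A x h else 0
  have e : (SSet.chainComplexMap A.ι R).f m ≫ ρ = 𝟙 _ := by
    refine subcomplexChain_hom_ext R A fun x hx => ?_
    rw [← Category.assoc, subcomplexι_comp, ι_chainDesc, dif_pos hx, Category.comp_id]
  exact mono_of_mono_fac e

/-- A map of chain groups restricts to simplicial subsets if the image of every simplex does. -/
lemma exists_chainComplex_lift {S T : SSet.{u}} (A : S.Subcomplex) (B : T.Subcomplex) {k l : ℕ}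
    (φ : (S.chainComplex R).X k ⟶ (T.chainComplex R).X l)
    (h : ∀ x ∈ A.obj (op ⦋k⦌), ∃ ψ : R ⟶ ((B : SSet).chainComplex R).X l,
      ψ ≫ (SSet.chainComplexMap B.ι R).f l = S.ιChainComplex x ≫ φ) :
    ∃ ψ : ((A : SSet).chainComplex R).X k ⟶ ((B : SSet).chainComplex R).X l,
      ψ ≫ (SSet.chainComplexMap B.ι R).f l = (SSet.chainComplexMap A.ι R).f k ≫ φ := by
  choose ψ hψ using h
  refine ⟨chainDesc R fun x => ψ x.1 x.2, subcomplexChain_hom_ext R A fun x hx => ?_⟩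
  rw [← Category.assoc, ← Category.assoc, subcomplexι_comp, ← hψ x hx]
  congr 1
  exact ι_chainDesc R (S := (A : SSet)) (fun x => ψ x.1 x.2) ⟨x, hx⟩

variable {X Y : Type u}

lemma exists_chainComplex_lift_map (A : (tupleSSet X).Subcomplex) (B : (tupleSSet Y).Subcomplex)
    (f : X → Y) (m : ℕ)
    (h : ∀ x : Fin (m + 1) → X, x ∈ A.obj (op ⦋m⦌) → f ∘ x ∈ B.obj (op ⦋m⦌)) :
    ∃ ψ : ((A : SSet).chainComplex R).X m ⟶ ((B : SSet).chainComplex R).X m,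
      ψ ≫ (SSet.chainComplexMap B.ι R).f m =
        (SSet.chainComplexMap A.ι R).f m ≫ (SSet.chainComplexMap (tupleSSetMap f) R).f m := by
  refine exists_chainComplex_lift R A B _ fun x hx => ⟨subcomplexι R B _ (h x hx), ?_⟩
  exact (subcomplexι_comp R B _ _).trans
    (SSet.ι_chainComplexMap_f (tupleSSet X) (tupleSSet Y) (tupleSSetMap f) R x).symm

/-- Makes the abstract chain homotopy explicit on simplices, so that restricting it amounts to a
condition on each prism simplex. The sign appears because the homotopy runs from `f` to `g`, while
the boundary of the alternating prism sum contributes `g - f`. -/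
lemma ιChainComplex_prismHomotopy (f g : X → Y) (m : ℕ) (x : (tupleSSet X) _⦋m⦌) :
    (tupleSSet X).ιChainComplex (R := R) x ≫
      ((prismHomotopy f g).sSetChainComplexMap R).hom m (m + 1) =
    -∑ i : Fin (m + 1), ((-1 : ℤ) ^ (i : ℕ)) •
      (tupleSSet Y).ιChainComplex (n := m + 1) (prism f g i x) := by
  let κ (i : Fin (m + 1)) :
      ((tupleSSet X).chainComplex R).X m ⟶ ((tupleSSet Y).chainComplex R).X (m + 1) :=
    (Limits.sigmaConst.obj R).map ((prismHomotopy f g).h i)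
  have e : ((prismHomotopy f g).sSetChainComplexMap R).hom m (m + 1) =
      -∑ i : Fin (m + 1), ((-1 : ℤ) ^ (i : ℕ)) • κ i :=
    SimplicialObject.Homotopy.ToChainHomotopy.hom_eq
      ((prismHomotopy f g).whiskerRight (Limits.sigmaConst.obj R)) m
  rw [e, Preadditive.comp_neg, Preadditive.comp_sum]
  congr 1
  refine Finset.sum_congr rfl fun i _ => ?_
  rw [Preadditive.comp_zsmul]
  congr 1
  refine (Limits.Sigma.ι_comp_map' (f := fun _ : Fin (m + 1) → X => R)
    (g := fun _ : Fin (m + 2) → Y => R) (prism f g i) (fun _ => 𝟙 R) x).trans ?_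
  exact Category.id_comp _

lemma exists_chainComplex_lift_prism (A : (tupleSSet X).Subcomplex) (B : (tupleSSet Y).Subcomplex)
    (f g : X → Y) (m : ℕ)
    (h : ∀ x : Fin (m + 1) → X, x ∈ A.obj (op ⦋m⦌) → ∀ i, prism f g i x ∈ B.obj (op ⦋m + 1⦌)) :
    ∃ ψ : ((A : SSet).chainComplex R).X m ⟶ ((B : SSet).chainComplex R).X (m + 1),
      ψ ≫ (SSet.chainComplexMap B.ι R).f (m + 1) =
        (SSet.chainComplexMap A.ι R).f m ≫
          ((prismHomotopy f g).sSetChainComplexMap R).hom m (m + 1) := by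
  refine exists_chainComplex_lift R A B _ fun x hx => ?_
  refine ⟨-∑ i : Fin (m + 1), ((-1 : ℤ) ^ (i : ℕ)) • subcomplexι R B _ (h x hx i), ?_⟩
  rw [ιChainComplex_prismHomotopy, Preadditive.neg_comp, Preadditive.sum_comp]
  congr 1
  refine Finset.sum_congr rfl fun i _ => ?_
  rw [Preadditive.zsmul_comp]
  congr 1
  exact subcomplexι_comp R B _ _

end SubcomplexChains

/-! ### The interleaving criterion for filtrations of the simplicial set of tuples. -/

section SSetInterleaving

open Simplicial Opposite

variable {X Y : Type u}

/-- The homotopy on simplicial chains from the composite of two maps to the identity. -/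
noncomputable def compHomotopy {C : Type v} [Category.{w} C] [Preadditive C]
    [Limits.HasCoproducts.{u} C] (R : C) (f : X → Y) (g : Y → X) :
    Homotopy (SSet.chainComplexMap (tupleSSetMap f) R ≫ SSet.chainComplexMap (tupleSSetMap g) R)
      (𝟙 ((tupleSSet X).chainComplex R)) :=
  (Homotopy.ofEq (((SSet.chainComplexFunctor C).obj R).map_comp _ _).symm).trans
    (((prismHomotopy (g ∘ f) id).sSetChainComplexMap R).trans
      (Homotopy.ofEq (((SSet.chainComplexFunctor C).obj R).map_id _)))

variable (R : Type v) [CommRing R]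

/-- Filtrations of the simplicial sets of tuples have interleaved homology if maps in both
directions and the prisms of their composites shift the filtrations by a bounded amount. -/
theorem interleaved_ssetHomology
    (A : ℝ ⥤ (tupleSSet X).Subcomplex) (B : ℝ ⥤ (tupleSSet Y).Subcomplex)
    (f : X → Y) (g : Y → X) (n : ℕ) (c : ℝ) (hc : 0 ≤ c)
    (hf : ∀ r, ∀ m ≤ n + 1, ∀ x : Fin (m + 1) → X, x ∈ (A.obj r).obj (op ⦋m⦌) →
      f ∘ x ∈ (B.obj (r + c)).obj (op ⦋m⦌))
    (hg : ∀ r, ∀ m ≤ n + 1, ∀ y : Fin (m + 1) → Y, y ∈ (B.obj r).obj (op ⦋m⦌) →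
      g ∘ y ∈ (A.obj (r + c)).obj (op ⦋m⦌))
    (hgf : ∀ r, ∀ m ≤ n, ∀ x : Fin (m + 1) → X, x ∈ (A.obj r).obj (op ⦋m⦌) →
      ∀ i, prism (g ∘ f) id i x ∈ (A.obj (r + c + c)).obj (op ⦋m + 1⦌))
    (hfg : ∀ r, ∀ m ≤ n, ∀ y : Fin (m + 1) → Y, y ∈ (B.obj r).obj (op ⦋m⦌) →
      ∀ i, prism (f ∘ g) id i y ∈ (B.obj (r + c + c)).obj (op ⦋m + 1⦌)) :
    Interleaved c hc (A ⋙ ssetHomology X R n) (B ⋙ ssetHomology Y R n) := by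
  let M : ModuleCat.{max u v} R := ModuleCat.of R (ULift.{u} R)
  let iA : A ⋙ SSet.Subcomplex.toSSetFunctor ⋙ (SSet.chainComplexFunctor _).obj M ⟶
      (Functor.const ℝ).obj ((tupleSSet X).chainComplex M) :=
    { app r := SSet.chainComplexMap (A.obj r).ι M
      naturality r s h := by
        refine Eq.trans ?_ (Category.comp_id _).symm
        exact (((SSet.chainComplexFunctor _).obj M).map_comp _ _).symm }
  let iB : B ⋙ SSet.Subcomplex.toSSetFunctor ⋙ (SSet.chainComplexFunctor _).obj M ⟶
      (Functor.const ℝ).obj ((tupleSSet Y).chainComplex M) :=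
    { app r := SSet.chainComplexMap (B.obj r).ι M
      naturality r s h := by
        refine Eq.trans ?_ (Category.comp_id _).symm
        exact (((SSet.chainComplexFunctor _).obj M).map_comp _ _).symm }
  -- The two homotopies that come from equalities have zero components.
  have key : ∀ (Z W : Type u) (f : Z → W) (g : W → Z) (k : ℕ), (compHomotopy M f g).hom k (k + 1) =
      ((prismHomotopy (g ∘ f) id).sSetChainComplexMap M).hom k (k + 1) := fun Z W f g k =>
    (zero_add _).trans (add_zero _)
  exact interleaved_homology iA iB (fun r m => mono_chainComplexMap_ι M _ m)
    (fun r m => mono_chainComplexMap_ι M _ m) (SSet.chainComplexMap (tupleSSetMap f) M)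
    (SSet.chainComplexMap (tupleSSetMap g) M) (compHomotopy M f g) (compHomotopy M g f) n c hc
    (fun r m hm => exists_chainComplex_lift_map M _ _ f m (hf r m hm))
    (fun r m hm => exists_chainComplex_lift_map M _ _ g m (hg r m hm))
    (fun r m hm => by
      rw [key]
      exact exists_chainComplex_lift_prism M _ _ (g ∘ f) id m (hgf r m hm))
    (fun r m hm => by
      rw [key]
      exact exists_chainComplex_lift_prism M _ _ (f ∘ g) id m (hfg r m hm))

end SSetInterleaving

/-! ### Generators, universal property and restriction of oriented chains. -/

section OrientedChainMaps

variable {ι : Type u} {K L : PreAbstractSimplicialComplex ι} {n : ℕ} (R : Type v) [CommRing R]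

/-- The oriented chain of a tuple. -/
noncomputable def simplexChain (x : Tuple K n) : OrientedChains R K n :=
  Submodule.Quotient.mk (Finsupp.single x 1)

lemma simplexChain_of_not_injective (x : Tuple K n) (hx : ¬ Function.Injective x.1) :
    simplexChain R x = 0 :=
  (Submodule.Quotient.mk_eq_zero _).2 (Submodule.subset_span (Or.inl ⟨x, hx, rfl⟩))

lemma simplexChain_perm (x : Tuple K n) (π : Equiv.Perm (Fin (n + 1))) :
    simplexChain R (x.perm π) = ((Equiv.Perm.sign π : ℤ) : R) • simplexChain R x :=
  (Submodule.Quotient.eq _).2 (Submodule.subset_span (Or.inr ⟨x, π, rfl⟩))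

lemma orientedBoundary_simplexChain (x : Tuple K (n + 1)) :
    orientedBoundary R K n (simplexChain R x) =
      ∑ i : Fin (n + 2), (-1 : R) ^ (i : ℕ) • simplexChain R (x.face i) := by
  change (orientationRel R K n).mkQ (tupleBoundary R K n (Finsupp.single x 1)) = _
  rw [tupleBoundary_single, map_sum]
  simp only [map_smul]
  rfl

lemma orientedIncl_simplexChain (h : K ≤ L) (x : Tuple K n) :
    orientedIncl R h n (simplexChain R x) = simplexChain R (x.incl h) := by
  change (orientationRel R L n).mkQ (Finsupp.mapDomain (Tuple.incl h) (Finsupp.single x 1)) = _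
  rw [Finsupp.mapDomain_single]
  rfl

variable {R}

/-- Tuples with a repeated vertex are zero, so only injective tuples need checking. The prism
formula is verified only on these. -/
lemma orientedChains_hom_ext {M : Type w} [AddCommGroup M] [Module R M]
    {φ ψ : OrientedChains R K n →ₗ[R] M}
    (h : ∀ x : Tuple K n, Function.Injective x.1 → φ (simplexChain R x) = ψ (simplexChain R x)) :
    φ = ψ := by
  ext x
  by_cases hx : Function.Injective x.1
  · exact h x hx
  · have := simplexChain_of_not_injective R x hx
    change φ (simplexChain R x) = ψ (simplexChain R x)
    rw [this, map_zero, map_zero]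

/-- The linear map on oriented chains with prescribed values on tuples. -/
noncomputable def orientedDesc {M : Type w} [AddCommGroup M] [Module R M] (F : Tuple K n → M)
    (h₀ : ∀ x, ¬ Function.Injective x.1 → F x = 0)
    (h₁ : ∀ x π, F (x.perm π) = ((Equiv.Perm.sign π : ℤ) : R) • F x) :
    OrientedChains R K n →ₗ[R] M :=
  Submodule.liftQ _ (Finsupp.linearCombination R F) <| Submodule.span_le.2 <| by
    rintro c (⟨x, hx, rfl⟩ | ⟨x, π, rfl⟩)
    · simp [h₀ x hx]
    · simp [h₁ x π]

lemma orientedDesc_simplexChain {M : Type w} [AddCommGroup M] [Module R M] (F : Tuple K n → M)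
    (h₀ : ∀ x, ¬ Function.Injective x.1 → F x = 0)
    (h₁ : ∀ x π, F (x.perm π) = ((Equiv.Perm.sign π : ℤ) : R) • F x) (x : Tuple K n) :
    orientedDesc F h₀ h₁ (simplexChain R x) = F x := by
  change Finsupp.linearCombination R F (Finsupp.single x 1) = F x
  simp

variable (R) in
-- Sending the tuples that do not span a simplex of `K` to zero is a retraction. It respects the
-- orientation relations because permuting a tuple preserves its vertex set.
lemma orientedIncl_injective (h : K ≤ L) (n : ℕ) :
    Function.Injective (orientedIncl R h n) := by
  classical
  let ρ : OrientedChains R L n →ₗ[R] OrientedChains R K n :=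
    orientedDesc (fun x => if hx : Finset.univ.image x.1 ∈ K.faces then
        simplexChain R (⟨x.1, by convert hx⟩ : Tuple K n) else 0)
      (fun x hx => by
        split_ifs with hK
        · exact simplexChain_of_not_injective R _ hx
        · rfl)
      (fun x π => by
        have e : Finset.univ.image (x.perm π).1 = Finset.univ.image x.1 := by
          ext a
          simp only [Finset.mem_image, Finset.mem_univ, true_and, Tuple.perm, Function.comp]
          exact π.exists_congr_left.trans (by simp)
        simp only [e]
        split_ifs with hK
        · exact simplexChain_perm R (⟨x.1, by convert hK⟩ : Tuple K n) π
        · rw [smul_zero])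
  have e : ρ ∘ₗ orientedIncl R h n = LinearMap.id := by
    refine orientedChains_hom_ext fun x _ => ?_
    rw [LinearMap.comp_apply, orientedIncl_simplexChain, orientedDesc_simplexChain, dif_pos]
    · rfl
    · convert x.2
      rfl
  exact Function.LeftInverse.injective (g := ρ) fun c => LinearMap.congr_fun e c

/-- A map of oriented chains restricts to subcomplexes if the image of every simplex does. -/
lemma exists_orientedChains_lift {κ : Type u} {K K' : PreAbstractSimplicialComplex ι}
    {L L' : PreAbstractSimplicialComplex κ} (hK : K ≤ K') (hL : L ≤ L') {k l : ℕ}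
    (φ : OrientedChains R K' k →ₗ[R] OrientedChains R L' l)
    (h : ∀ x : Tuple K k,
      φ (simplexChain R (x.incl hK)) ∈ LinearMap.range (orientedIncl R hL l)) :
    ∃ ψ : OrientedChains R K k →ₗ[R] OrientedChains R L l,
      orientedIncl R hL l ∘ₗ ψ = φ ∘ₗ orientedIncl R hK k := by
  have hr : ∀ c, (φ ∘ₗ orientedIncl R hK k) c ∈ LinearMap.range (orientedIncl R hL l) := by
    intro c
    obtain ⟨c, rfl⟩ := Submodule.Quotient.mk_surjective _ c
    induction c using Finsupp.induction_linear with
    | zero =>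
      rw [Submodule.Quotient.mk_zero, map_zero]
      exact zero_mem (LinearMap.range (orientedIncl R hL l))
    | add a b ha hb =>
      rw [Submodule.Quotient.mk_add, map_add]
      exact add_mem ha hb
    | single x a =>
      have : (Submodule.Quotient.mk (Finsupp.single x a) : OrientedChains R K k) =
          a • simplexChain R x := by
        rw [simplexChain, ← Submodule.Quotient.mk_smul, Finsupp.smul_single, smul_eq_mul, mul_one]
      rw [this, map_smul, LinearMap.comp_apply, orientedIncl_simplexChain]
      exact Submodule.smul_mem _ _ (h x)
  let e := LinearEquiv.ofInjective _ (orientedIncl_injective R hL l)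
  refine ⟨e.symm.toLinearMap ∘ₗ (φ ∘ₗ orientedIncl R hK k).codRestrict _ hr, ?_⟩
  ext1
  ext x
  exact congrArg Subtype.val (e.apply_symm_apply _)

end OrientedChainMaps

/-! ### Oriented chains of the full simplicial complex. -/

section VertexMaps

variable {X Y : Type u} {n : ℕ} (R : Type v) [CommRing R]

/-- A tuple of vertices of the full simplicial complex. -/
def fullTuple (x : Fin (n + 1) → X) : Tuple (⊤ : PreAbstractSimplicialComplex X) n :=
  ⟨x, by classical exact Finset.univ_nonempty.image x⟩

/-- The oriented chain of a tuple in the full simplicial complex. -/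
noncomputable def fullChain (x : Fin (n + 1) → X) :
    OrientedChains R (⊤ : PreAbstractSimplicialComplex X) n :=
  simplexChain R (fullTuple x)

lemma fullChain_of_not_injective {x : Fin (n + 1) → X} (hx : ¬ Function.Injective x) :
    fullChain R x = 0 :=
  simplexChain_of_not_injective R _ hx

lemma fullChain_perm (x : Fin (n + 1) → X) (π : Equiv.Perm (Fin (n + 1))) :
    fullChain R (x ∘ π) = ((Equiv.Perm.sign π : ℤ) : R) • fullChain R x :=
  simplexChain_perm R (fullTuple x) π

lemma orientedBoundary_fullChain (x : Fin (n + 2) → X) :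
    orientedBoundary R ⊤ n (fullChain R x) =
      ∑ i : Fin (n + 2), (-1 : R) ^ (i : ℕ) • fullChain R (i.removeNth x) :=
  orientedBoundary_simplexChain R (fullTuple x)

lemma orientedBoundary_fullChain_cons (a : X) (x : Fin (n + 1) → X) :
    orientedBoundary R ⊤ n (fullChain R (Fin.cons a x : Fin (n + 2) → X)) =
      fullChain R x - ∑ i : Fin (n + 1),
        (-1 : R) ^ (i : ℕ) • fullChain R (Fin.cons a (i.removeNth x) : Fin (n + 1) → X) := by
  rw [orientedBoundary_fullChain, Fin.sum_univ_succ, sub_eq_add_neg, ← Finset.sum_neg_distrib]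
  congr 1
  · simp [Fin.removeNth_zero]
  · refine Finset.sum_congr rfl fun i _ => ?_
    have e : i.succ.removeNth (Fin.cons a x : Fin (n + 2) → X) =
        (Fin.cons a (i.removeNth x) : Fin (n + 1) → X) := by
      funext j
      refine Fin.cases ?_ (fun j => ?_) j
      · rfl
      · simp [Fin.removeNth, Fin.succ_succAbove_succ]
    rw [e, Fin.val_succ, pow_succ, mul_neg_one, neg_smul]

/-- Moving `a` from the front into slot `i` is a cycle of sign `(-1)^i`, which cancels the
coefficient. -/
lemma fullChain_cons_removeNth (a : X) (x : Fin (n + 1) → X) (i : Fin (n + 1)) :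
    (-1 : R) ^ (i : ℕ) • fullChain R (Fin.cons a (i.removeNth x) : Fin (n + 1) → X) =
      fullChain R (Function.update x i a) := by
  rw [← Fin.insertNth_removeNth, ← Fin.cons_comp_cycleRange, fullChain_perm, Fin.sign_cycleRange]
  simp

/-- The map of oriented chains of full simplicial complexes induced by a map of vertices. -/
noncomputable def vertexMap (f : X → Y) (n : ℕ) :
    OrientedChains R (⊤ : PreAbstractSimplicialComplex X) n →ₗ[R]
      OrientedChains R (⊤ : PreAbstractSimplicialComplex Y) n :=
  orientedDesc (fun x => fullChain R (f ∘ x.1))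
    (fun _ hx => fullChain_of_not_injective R fun h => hx h.of_comp)
    (fun x π => fullChain_perm R (f ∘ x.1) π)

lemma vertexMap_fullChain (f : X → Y) (x : Fin (n + 1) → X) :
    vertexMap R f n (fullChain R x) = fullChain R (f ∘ x) :=
  orientedDesc_simplexChain _ _ _ _

lemma vertexMap_orientedBoundary (f : X → Y) (n : ℕ) :
    orientedBoundary R ⊤ n ∘ₗ vertexMap R f (n + 1) =
      vertexMap R f n ∘ₗ orientedBoundary R ⊤ n := by
  refine orientedChains_hom_ext fun x _ => ?_
  change orientedBoundary R ⊤ n (vertexMap R f (n + 1) (fullChain R x.1)) =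
    vertexMap R f n (orientedBoundary R ⊤ n (fullChain R x.1))
  rw [vertexMap_fullChain, orientedBoundary_fullChain, orientedBoundary_fullChain, map_sum]
  refine Finset.sum_congr rfl fun i _ => ?_
  rw [map_smul, vertexMap_fullChain]
  rfl

end VertexMaps

/-! ### A prism operator on oriented chains, from a linear order of the vertices. -/

section OrientedHomotopy

variable {X : Type u} [LinearOrder X] {n : ℕ} (R : Type v) [CommRing R]

/-- The tuple obtained by applying `g` to the entries that exceed the `i`-th entry. -/
def moveAbove (g : X → X) (x : Fin (n + 1) → X) (i : Fin (n + 1)) : Fin (n + 1) → X :=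
  fun j => if x j ≤ x i then x j else g (x j)

/-- The chains `-∑ᵢ (g xᵢ, y₀, …, yₙ)`, where `yⱼ` is `xⱼ` for `xⱼ ≤ xᵢ` and `g xⱼ` otherwise. On
increasing tuples this is the alternating sum of the simplices of the prism over `x`. -/
noncomputable def orientedPrism (g : X → X) (n : ℕ) :
    OrientedChains R (⊤ : PreAbstractSimplicialComplex X) n →ₗ[R]
      OrientedChains R (⊤ : PreAbstractSimplicialComplex X) (n + 1) :=
  orientedDesc
    (fun x => -∑ i : Fin (n + 1),
      fullChain R (Fin.cons (g (x.1 i)) (moveAbove g x.1 i) : Fin (n + 2) → X))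
    (fun x hx => by
      rw [neg_eq_zero]
      refine Finset.sum_eq_zero fun i _ => fullChain_of_not_injective R fun h => hx ?_
      intro a b hab
      have : moveAbove g x.1 i a = moveAbove g x.1 i b := by simp [moveAbove, hab]
      exact Fin.succ_injective _ (h (by simpa using this)))
    (fun x π => by
      rw [smul_neg, Finset.smul_sum, ← Equiv.sum_comp π (fun i => ((Equiv.Perm.sign π : ℤ) : R) •
        fullChain R (Fin.cons (g (x.1 i)) (moveAbove g x.1 i) : Fin (n + 2) → X))]
      congr 1
      refine Finset.sum_congr rfl fun i _ => ?_
      -- The permutation `decomposeFin.symm (0, π)` fixes the front entry and acts by `π` on the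
      -- others, so its sign is that of `π`. The rest of a prism simplex depends on `x` only through
      -- comparisons of values, hence is permuted along with `x`.
      have e := fullChain_perm R
        (Fin.cons (g (x.1 (π i))) (moveAbove g x.1 (π i)) : Fin (n + 2) → X)
        (Equiv.Perm.decomposeFin.symm (0, π))
      rw [Equiv.Perm.decomposeFin.symm_sign, if_pos rfl, one_mul] at e
      rw [← e]
      congr 1
      funext j
      refine Fin.cases ?_ (fun j => ?_) j
      · simp [Tuple.perm]
      · simp [Tuple.perm, moveAbove])

lemma orientedPrism_fullChain (g : X → X) (x : Fin (n + 1) → X) :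
    orientedPrism R g n (fullChain R x) = -∑ i : Fin (n + 1),
      fullChain R (Fin.cons (g (x i)) (moveAbove g x i) : Fin (n + 2) → X) :=
  orientedDesc_simplexChain _ _ _ _

/-- Moving the entries of an injective tuple one at a time, in decreasing order. -/
lemma sum_moveAbove_sub_sum_update (g : X → X) (x : Fin (n + 1) → X) (hx : Function.Injective x) :
    ∑ i, fullChain R (moveAbove g x i) -
      ∑ i, fullChain R (Function.update (moveAbove g x i) i (g (x i))) =
    fullChain R x - fullChain R (g ∘ x) := by
  let σ := Tuple.sort x
  have hσ : StrictMono (x ∘ σ) :=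
    (Tuple.monotone_sort x).strictMono_of_injective (hx.comp σ.injective)
  -- `G k` keeps the `k` smallest entries and moves the others. The two sums run over `G (i + 1)`
  -- and `G i`, so their difference telescopes from `g ∘ x` to `x`.
  let G : ℕ → OrientedChains R (⊤ : PreAbstractSimplicialComplex X) n := fun k =>
    fullChain R fun j => if (σ.symm j : ℕ) < k then x j else g (x j)
  have h₁ : ∀ i, fullChain R (moveAbove g x (σ i)) = G (i + 1) := fun i => by
    simp only [G]
    congr 1
    funext j
    have : x j ≤ x (σ i) ↔ (σ.symm j : ℕ) < i + 1 := by
      rw [Nat.lt_succ_iff, ← Fin.le_def, ← hσ.le_iff_le]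
      simp
    simp only [moveAbove, this]
  have h₂ : ∀ i, fullChain R (Function.update (moveAbove g x (σ i)) (σ i) (g (x (σ i)))) = G i :=
    fun i => by
    simp only [G]
    congr 1
    funext j
    have : x j < x (σ i) ↔ (σ.symm j : ℕ) < i := by
      rw [← Fin.lt_def, ← hσ.lt_iff_lt]
      simp
    simp only [← this]
    rcases eq_or_ne j (σ i) with rfl | hj
    · simp
    · rw [Function.update_of_ne hj]
      simp only [moveAbove, (hx.ne hj).le_iff_lt]
  rw [← Equiv.sum_comp σ, ← Equiv.sum_comp σ (fun i =>
    fullChain R (Function.update (moveAbove g x i) i (g (x i)))), ← Finset.sum_sub_distrib]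
  simp only [h₁, h₂]
  rw [Fin.sum_univ_eq_sum_range (fun i => G (i + 1) - G i), Finset.sum_range_sub]
  congr 1
  simp only [G]
  congr 1
  funext j
  rw [if_pos (σ.symm j).2]

/-- Deleting the front entry of the `i`-th prism simplex leaves `moveAbove g x i`; deleting slot `i`
of the rest and moving the front entry there gives the updated tuple. These two families telescope
to `g ∘ x` and `x`. The deletions of slots `k ≠ i` remain, written as a full sum minus its `i = k`
term, which also makes sense for `n = 0`; they cancel against the prism of the boundary. -/
lemma orientedBoundary_orientedPrism_fullChain (g : X → X) (x : Fin (n + 1) → X)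
    (hx : Function.Injective x) :
    orientedBoundary R ⊤ n (orientedPrism R g n (fullChain R x)) =
      fullChain R (g ∘ x) - fullChain R x +
        ∑ k : Fin (n + 1), (-1 : R) ^ (k : ℕ) • (∑ i : Fin (n + 1),
          fullChain R (Fin.cons (g (x i)) (k.removeNth (moveAbove g x i)) : Fin (n + 1) → X) -
          fullChain R (Fin.cons (g (x k)) (k.removeNth (moveAbove g x k)) : Fin (n + 1) → X)) := by
  have key := sum_moveAbove_sub_sum_update R g x hx
  rw [orientedPrism_fullChain, map_neg, map_sum]
  simp only [orientedBoundary_fullChain_cons, smul_sub, Finset.sum_sub_distrib,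
    fullChain_cons_removeNth, Finset.smul_sum]
  rw [Finset.sum_comm, ← sub_eq_zero]
  rw [← sub_eq_zero] at key
  rw [← neg_eq_zero, ← key]
  abel

lemma orientedPrism_comm_zero (g : X → X) :
    vertexMap R g 0 = orientedBoundary R ⊤ 0 ∘ₗ orientedPrism R g 0 + LinearMap.id := by
  refine orientedChains_hom_ext fun x hx => ?_
  change vertexMap R g 0 (fullChain R x.1) =
    orientedBoundary R ⊤ 0 (orientedPrism R g 0 (fullChain R x.1)) + fullChain R x.1
  rw [orientedBoundary_orientedPrism_fullChain R g _ hx, vertexMap_fullChain]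
  simp

lemma orientedPrism_comm_succ (g : X → X) (n : ℕ) :
    vertexMap R g (n + 1) = orientedPrism R g n ∘ₗ orientedBoundary R ⊤ n +
      orientedBoundary R ⊤ (n + 1) ∘ₗ orientedPrism R g (n + 1) + LinearMap.id := by
  refine orientedChains_hom_ext fun x hx => ?_
  change vertexMap R g (n + 1) (fullChain R x.1) =
    orientedPrism R g n (orientedBoundary R ⊤ n (fullChain R x.1)) +
    orientedBoundary R ⊤ (n + 1) (orientedPrism R g (n + 1) (fullChain R x.1)) + fullChain R x.1
  rw [orientedBoundary_orientedPrism_fullChain R g _ hx, vertexMap_fullChain,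
    orientedBoundary_fullChain, map_sum]
  have e : ∀ k : Fin (n + 2), orientedPrism R g n ((-1 : R) ^ (k : ℕ) •
      fullChain R (k.removeNth x.1)) = -((-1 : R) ^ (k : ℕ) • (∑ i : Fin (n + 2),
          fullChain R (Fin.cons (g (x.1 i)) (k.removeNth (moveAbove g x.1 i)) : Fin (n + 2) → X) -
          fullChain R (Fin.cons (g (x.1 k)) (k.removeNth (moveAbove g x.1 k)) :
            Fin (n + 2) → X))) := by
    intro k
    -- Once `i = k` is split off, the other `i` index the entries of the `k`-th face, and
    -- `moveAbove` commutes with deleting slot `k`.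
    rw [map_smul, orientedPrism_fullChain, smul_neg, Fin.sum_univ_succAbove _ k, add_sub_cancel_left]
    rfl
  rw [Finset.sum_congr rfl fun k _ => e k, Finset.sum_neg_distrib]
  abel

end OrientedHomotopy

/-! ### The interleaving criterion for filtrations of the full simplicial complex. -/

section OrientedInterleaving

open HomologicalComplex

variable {X Y : Type u} (R : Type v) [CommRing R]

/-- The chain map of full simplicial complexes induced by a map of vertices. -/
noncomputable def vertexChainMap (f : X → Y) :
    orientedChainComplex R (⊤ : PreAbstractSimplicialComplex X) ⟶
      orientedChainComplex R (⊤ : PreAbstractSimplicialComplex Y) :=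
  ChainComplex.ofHom (X := orientedChainComplex R ⊤) (Y := orientedChainComplex R ⊤)
    (fun n => ModuleCat.ofHom (vertexMap R f n)) (fun n => by
      simp only [orientedChainComplex, ChainComplex.of_d]
      exact congrArg ModuleCat.ofHom (vertexMap_orientedBoundary R f n))

/-- The components of the prism homotopy. -/
noncomputable def orientedPrismHom [LinearOrder X] (g : X → X) (k l : ℕ) :
    (orientedChainComplex R (⊤ : PreAbstractSimplicialComplex X)).X k ⟶
      (orientedChainComplex R (⊤ : PreAbstractSimplicialComplex X)).X l :=
  if h : k + 1 = l then h ▸ ModuleCat.ofHom (orientedPrism R g k) else 0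

lemma orientedPrismHom_eq [LinearOrder X] (g : X → X) (k : ℕ) :
    orientedPrismHom R g k (k + 1) = ModuleCat.ofHom (orientedPrism R g k) :=
  dif_pos rfl

lemma orientedChainComplex_d (K : PreAbstractSimplicialComplex X) (n : ℕ) :
    (orientedChainComplex R K).d (n + 1) n = ModuleCat.ofHom (orientedBoundary R K n) := by
  simp only [orientedChainComplex, ChainComplex.of_d]

/-- The homotopy on oriented chains from the composite of two maps to the identity. -/
noncomputable def orientedPrismHomotopy [LinearOrder X] (f : X → Y) (g : Y → X) :
    Homotopy (vertexChainMap R f ≫ vertexChainMap R g)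
      (𝟙 (orientedChainComplex R (⊤ : PreAbstractSimplicialComplex X))) where
  hom k l := orientedPrismHom R (g ∘ f) k l
  zero k l hkl := dif_neg hkl
  comm n := by
    have e : ∀ m, (vertexChainMap R f ≫ vertexChainMap R g).f m =
        ModuleCat.ofHom (vertexMap R (g ∘ f) m) := fun m => by
      refine ModuleCat.hom_ext (orientedChains_hom_ext fun x _ => ?_)
      change vertexMap R g m (vertexMap R f m (fullChain R x.1)) =
        vertexMap R (g ∘ f) m (fullChain R x.1)
      rw [vertexMap_fullChain, vertexMap_fullChain, vertexMap_fullChain]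
      rfl
    rw [e]
    cases n with
    | zero =>
      rw [prevD_eq (j' := 1) (w := by simp), dNext_eq_zero _ _ (by simp), zero_add,
        orientedPrismHom_eq, orientedChainComplex_d]
      exact congrArg ModuleCat.ofHom (orientedPrism_comm_zero R (g ∘ f))
    | succ n =>
      rw [dNext_eq (i' := n) (w := by simp), prevD_eq (j' := n + 2) (w := by simp),
        orientedPrismHom_eq, orientedPrismHom_eq, orientedChainComplex_d, orientedChainComplex_d]
      exact congrArg ModuleCat.ofHom (orientedPrism_comm_succ R (g ∘ f) n)

variable {R}

lemma exists_orientedChainComplex_lift {K : PreAbstractSimplicialComplex X}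
    {L : PreAbstractSimplicialComplex Y} {k l : ℕ}
    (φ : OrientedChains R (⊤ : PreAbstractSimplicialComplex X) k →ₗ[R]
      OrientedChains R (⊤ : PreAbstractSimplicialComplex Y) l)
    (h : ∀ x : Tuple K k,
      φ (fullChain R x.1) ∈ LinearMap.range (orientedIncl R (le_top : L ≤ ⊤) l)) :
    ∃ ψ : (orientedChainComplex R K).X k ⟶ (orientedChainComplex R L).X l,
      ψ ≫ ((orientedChainFunctor Y R).map (homOfLE (le_top : L ≤ ⊤))).f l =
        ((orientedChainFunctor X R).map (homOfLE (le_top : K ≤ ⊤))).f k ≫ ModuleCat.ofHom φ := by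
  obtain ⟨ψ, hψ⟩ := exists_orientedChains_lift (le_top : K ≤ ⊤) (le_top : L ≤ ⊤) φ h
  exact ⟨ModuleCat.ofHom ψ, congrArg ModuleCat.ofHom hψ⟩

lemma fullChain_mem_range {L : PreAbstractSimplicialComplex X} {l : ℕ} {x : Fin (l + 1) → X}
    (h : ∃ t : Tuple L l, t.1 = x) :
    fullChain R x ∈ LinearMap.range (orientedIncl R (le_top : L ≤ ⊤) l) := by
  obtain ⟨t, rfl⟩ := h
  exact ⟨simplexChain R t, orientedIncl_simplexChain R _ _⟩

variable (R) in
/-- Filtrations of full simplicial complexes have interleaved homology if maps in both directions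
and the prisms of their composites shift the filtrations by a bounded amount. -/
theorem interleaved_complexHomology [LinearOrder X] [LinearOrder Y]
    (A : ℝ ⥤ PreAbstractSimplicialComplex X) (B : ℝ ⥤ PreAbstractSimplicialComplex Y)
    (f : X → Y) (g : Y → X) (n : ℕ) (c : ℝ) (hc : 0 ≤ c)
    (hf : ∀ r, ∀ m ≤ n + 1, ∀ x : Tuple (A.obj r) m, ∃ t : Tuple (B.obj (r + c)) m, t.1 = f ∘ x.1)
    (hg : ∀ r, ∀ m ≤ n + 1, ∀ y : Tuple (B.obj r) m, ∃ t : Tuple (A.obj (r + c)) m, t.1 = g ∘ y.1)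
    (hgf : ∀ r, ∀ m ≤ n, ∀ x : Tuple (A.obj r) m, ∀ i,
      ∃ t : Tuple (A.obj (r + c + c)) (m + 1),
        t.1 = Fin.cons (g (f (x.1 i))) (moveAbove (g ∘ f) x.1 i))
    (hfg : ∀ r, ∀ m ≤ n, ∀ y : Tuple (B.obj r) m, ∀ i,
      ∃ t : Tuple (B.obj (r + c + c)) (m + 1),
        t.1 = Fin.cons (f (g (y.1 i))) (moveAbove (f ∘ g) y.1 i)) :
    Interleaved c hc (A ⋙ complexHomology X R n) (B ⋙ complexHomology Y R n) := by
  let iA : A ⋙ orientedChainFunctor X R ⟶ (Functor.const ℝ).obj (orientedChainComplex R ⊤) :=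
    { app r := (orientedChainFunctor X R).map (homOfLE le_top)
      naturality r s h := by
        refine Eq.trans ?_ (Category.comp_id _).symm
        exact ((orientedChainFunctor X R).map_comp (A.map h) (homOfLE le_top)).symm }
  let iB : B ⋙ orientedChainFunctor Y R ⟶ (Functor.const ℝ).obj (orientedChainComplex R ⊤) :=
    { app r := (orientedChainFunctor Y R).map (homOfLE le_top)
      naturality r s h := by
        refine Eq.trans ?_ (Category.comp_id _).symm
        exact ((orientedChainFunctor Y R).map_comp (B.map h) (homOfLE le_top)).symm }
  have prism_lift : ∀ (Z W : Type u) [LinearOrder Z] (f : Z → W) (g : W → Z)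
      (K L : PreAbstractSimplicialComplex Z) (k : ℕ)
      (_ : ∀ x : Tuple K k, ∀ i, ∃ t : Tuple L (k + 1),
        t.1 = Fin.cons (g (f (x.1 i))) (moveAbove (g ∘ f) x.1 i)),
      ∃ ψ : (orientedChainComplex R K).X k ⟶ (orientedChainComplex R L).X (k + 1),
        ψ ≫ ((orientedChainFunctor Z R).map (homOfLE (le_top : L ≤ ⊤))).f (k + 1) =
          ((orientedChainFunctor Z R).map (homOfLE (le_top : K ≤ ⊤))).f k ≫
            (orientedPrismHomotopy R f g).hom k (k + 1) := by
    intro Z W _ f g K L k h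
    change ∃ ψ, _ = _ ≫ orientedPrismHom R (g ∘ f) k (k + 1)
    rw [orientedPrismHom_eq]
    refine exists_orientedChainComplex_lift _ fun x => ?_
    rw [orientedPrism_fullChain]
    exact neg_mem (sum_mem fun i _ => fullChain_mem_range (h x i))
  have mono : ∀ (Z : Type u) (K : PreAbstractSimplicialComplex Z) (m : ℕ),
      Mono (((orientedChainFunctor Z R).map (homOfLE (le_top : K ≤ ⊤))).f m) := fun Z K m =>
    (ModuleCat.mono_iff_injective _).2 (orientedIncl_injective R le_top m)
  exact interleaved_homology iA iB (fun r m => mono _ _ m) (fun r m => mono _ _ m)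
    (vertexChainMap R f) (vertexChainMap R g) (orientedPrismHomotopy R f g)
    (orientedPrismHomotopy R g f) n c hc
    (fun r m hm => exists_orientedChainComplex_lift (vertexMap R f m) fun x => by
      rw [vertexMap_fullChain]
      exact fullChain_mem_range (hf r m hm x))
    (fun r m hm => exists_orientedChainComplex_lift (vertexMap R g m) fun x => by
      rw [vertexMap_fullChain]
      exact fullChain_mem_range (hg r m hm x))
    (fun r m hm => prism_lift _ _ f g _ _ m (hgf r m hm))
    (fun r m hm => prism_lift _ _ g f _ _ m (hfg r m hm))

end OrientedInterleaving

/-! ### Interleavings of the three persistence modules from almost inverse maps. -/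

section Stability

open Simplicial Opposite

variable {X Y : Type u} [MetricSpace X] [MetricSpace Y]

/-- Compares the prism simplex with the degenerate tuple that repeats `x i`, whose weight and length
are controlled by those of `x`. -/
lemma dist_prism_le {u : X → X} {δ : ℝ} (hδ : 0 ≤ δ) (hu : ∀ a, dist (u a) a ≤ δ) {m : ℕ}
    (i : Fin (m + 1)) (x : Fin (m + 1) → X) (k : Fin (m + 2)) :
    dist (prism u id i x k) (x (i.predAbove k)) ≤ δ := by
  unfold prism
  split_ifs
  · exact hu _
  · simpa using hδ

/-- A family of left infinite intervals whose endpoints move at unit speed. -/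
def IsScale (scale : ℝ ⥤ LowerSet ℝ) : Prop :=
  ∀ a b r c : ℝ, a ∈ scale.obj r → b ≤ a + c → b ∈ scale.obj (r + c)

lemma isScale_strictScale : IsScale strictScale := fun a b r c ha hb => by
  have ha : a < r := ha
  change b < r + c
  linarith

lemma isScale_nonstrictScale : IsScale nonstrictScale := fun a b r c ha hb => by
  have ha : a ≤ r := ha
  change b ≤ r + c
  linarith

lemma IsScale.mem_add_add {scale : ℝ ⥤ LowerSet ℝ} (h : IsScale scale) {a b r c : ℝ}
    (ha : a ∈ scale.obj r) (hb : b ≤ a + 2 * c) : b ∈ scale.obj (r + c + c) := by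
  rw [add_assoc, ← two_mul]
  exact h a b r _ ha hb

variable {f : X → Y} {g : Y → X} {δ : ℝ} {scale : ℝ ⥤ LowerSet ℝ} (R : Type v) [CommRing R] (n : ℕ)

/-- All tuples involved, both the images in degrees at most `n + 1` and the prisms over degrees at
most `n`, have at most `n + 2` entries. Thus at most `n + 1` steps occur, and the constant `n + 2`
leaves slack. -/
theorem interleaved_vrSSetModule (hfg : AlmostInverse f g δ) (hs : IsScale scale)
    {p : ENNReal} (hp : 1 ≤ p) {c : ℝ} (hc : 0 ≤ c)
    (hcδ : ((n + 2 : ℕ) : ℝ) ^ (1 / p).toReal * δ = c) :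
    Interleaved c hc (vrSSetModule X R scale p n) (vrSSetModule Y R scale p n) := by
  have map_mem : ∀ (Z W : Type u) [MetricSpace Z] [MetricSpace W] (f : Z → W)
      (_ : ∀ x x', dist (f x) (f x') ≤ dist x x' + δ) (r : ℝ) (m : ℕ) (_ : m ≤ n + 1)
      (x : Fin (m + 1) → Z) (_ : weight p x ∈ scale.obj r), weight p (f ∘ x) ∈ scale.obj (r + c) :=
    fun Z W _ _ f hf r m hm x hx => hs _ _ _ _ hx
      (hcδ ▸ weight_le_add hp (by omega) hfg.nonneg fun i j => hf _ _)
  have prism_mem : ∀ (Z : Type u) [MetricSpace Z] (w : Z → Z) (_ : ∀ a, dist (w a) a ≤ δ) (r : ℝ)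
      (m : ℕ) (_ : m ≤ n) (x : Fin (m + 1) → Z) (_ : weight p x ∈ scale.obj r) (i : Fin (m + 1)),
      weight p (prism w id i x) ∈ scale.obj (r + c + c) := fun Z _ w hw r m hm x hx i => by
    have h₁ : weight p (x ∘ i.predAbove) ≤ weight p x :=
      weight_comp_le p x _ (Fin.predAbove_right_monotone i)
    have h₂ := weight_le_add (N := n + 2) hp (by omega) (by linarith [hfg.nonneg])
      (dist_le_add_of_dist_le (x := x ∘ i.predAbove) (dist_prism_le hfg.nonneg hw i x))
    exact hs.mem_add_add hx (by linarith)
  exact interleaved_ssetHomology R (scale ⋙ (vrSSet_mono X p).functor)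
    (scale ⋙ (vrSSet_mono Y p).functor) f g n c hc (map_mem X Y f hfg.dist_map_le)
    (map_mem Y X g hfg.dist_inv_le) (prism_mem X (g ∘ f) hfg.dist_left_le)
    (prism_mem Y (f ∘ g) hfg.dist_right_le)

theorem interleaved_blurredMagnitudeHomology (hfg : AlmostInverse f g δ) (hs : IsScale scale)
    {c : ℝ} (hc : 0 ≤ c) (hcδ : ((n + 2 : ℕ) : ℝ) * δ = c) :
    Interleaved c hc (blurredMagnitudeHomology X R scale n)
      (blurredMagnitudeHomology Y R scale n) := by
  have map_mem : ∀ (Z W : Type u) [MetricSpace Z] [MetricSpace W] (f : Z → W)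
      (_ : ∀ x x', dist (f x) (f x') ≤ dist x x' + δ) (r : ℝ) (m : ℕ) (_ : m ≤ n + 1)
      (x : Fin (m + 1) → Z) (_ : pathLength x ∈ scale.obj r),
      pathLength (f ∘ x) ∈ scale.obj (r + c) :=
    fun Z W _ _ f hf r m hm x hx => hs _ _ _ _ hx
      (hcδ ▸ pathLength_le_add (by omega) hfg.nonneg fun i j => hf _ _)
  have prism_mem : ∀ (Z : Type u) [MetricSpace Z] (w : Z → Z) (_ : ∀ a, dist (w a) a ≤ δ) (r : ℝ)
      (m : ℕ) (_ : m ≤ n) (x : Fin (m + 1) → Z) (_ : pathLength x ∈ scale.obj r) (i : Fin (m + 1)),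
      pathLength (prism w id i x) ∈ scale.obj (r + c + c) := fun Z _ w hw r m hm x hx i => by
    have h₁ : pathLength (x ∘ i.predAbove) ≤ pathLength x :=
      pathLength_comp_le x _ (Fin.predAbove_right_monotone i)
    have h₂ := pathLength_le_add (m := m + 1) (N := n + 2) (by omega) (by linarith [hfg.nonneg])
      (dist_le_add_of_dist_le (x := x ∘ i.predAbove) (dist_prism_le hfg.nonneg hw i x))
    exact hs.mem_add_add hx (by linarith)
  exact interleaved_ssetHomology R (scale ⋙ (magnitudeNerve_mono X).functor)
    (scale ⋙ (magnitudeNerve_mono Y).functor) f g n c hc (map_mem X Y f hfg.dist_map_le)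
    (map_mem Y X g hfg.dist_inv_le) (prism_mem X (g ∘ f) hfg.dist_left_le)
    (prism_mem Y (f ∘ g) hfg.dist_right_le)

/-- The minimum defining the weight of the vertex set is attained. The enumeration may be shorter
than the tuple, which is allowed to repeat vertices. -/
lemma exists_enumeration_of_tuple {p : ENNReal} {L : LowerSet ℝ} {m : ℕ}
    (t : Tuple (vrComplex X p L) m) :
    ∃ k ≤ m + 1, ∃ y : Fin k → X, Set.range y = Set.range t.1 ∧ weight p y ∈ L := by
  classical
  obtain ⟨x, -, hx⟩ := t
  obtain ⟨e, he⟩ := exists_weight_eq_finsetWeight p (Finset.univ.image x)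
  refine ⟨_, Finset.card_image_le.trans (by simp), fun i => e i, ?_, ?_⟩
  · ext a
    simp only [Set.mem_range]
    constructor
    · rintro ⟨i, rfl⟩
      simpa only [Finset.mem_image, Finset.mem_univ, true_and] using (e i).2
    · rintro ⟨j, rfl⟩
      exact ⟨e.symm ⟨x j, by simp⟩, by simp⟩
  · rw [he]
    convert hx

/-- Membership in the complex depends only on the set of entries, so any enumeration of that set, of
any length and with repetitions, can witness a small weight. -/
lemma exists_tuple_of_range_eq {p : ENNReal} {L : LowerSet ℝ} {m k : ℕ} {x : Fin (m + 1) → X}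
    {y : Fin k → X} (hr : Set.range y = Set.range x) (hw : weight p y ∈ L) :
    ∃ t : Tuple (vrComplex X p L) m, t.1 = x := by
  classical
  have h : finsetWeight p (Finset.univ.image x) ≤ weight p y :=
    finsetWeight_le_weight p y _ fun a => by
      rw [← Set.mem_range, hr]
      simp
  refine ⟨⟨x, Finset.univ_nonempty.image x, ?_⟩, rfl⟩
  have : finsetWeight p (Finset.univ.image x) ∈ L := L.lower h hw
  convert this

theorem interleaved_vrComplexModule (hfg : AlmostInverse f g δ) (hs : IsScale scale)
    {p : ENNReal} (hp : 1 ≤ p) {c : ℝ} (hc : 0 ≤ c)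
    (hcδ : ((n + 2 : ℕ) : ℝ) ^ (1 / p).toReal * δ = c) :
    Interleaved c hc (vrComplexModule X R scale p n) (vrComplexModule Y R scale p n) := by
  classical
  -- Any linear orders will do, as they only serve to define the prism operator and need no
  -- compatibility with the metrics.
  let _ : LinearOrder X := IsWellOrder.linearOrder WellOrderingRel
  let _ : LinearOrder Y := IsWellOrder.linearOrder WellOrderingRel
  have map_mem : ∀ (Z W : Type u) [MetricSpace Z] [MetricSpace W] (f : Z → W)
      (_ : ∀ x x', dist (f x) (f x') ≤ dist x x' + δ) (r : ℝ) (m : ℕ) (_ : m ≤ n + 1)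
      (x : Tuple (vrComplex Z p (scale.obj r)) m),
      ∃ t : Tuple (vrComplex W p (scale.obj (r + c))) m, t.1 = f ∘ x.1 := by
    intro Z W _ _ f hf r m hm x
    obtain ⟨k, hk, y, hy, hw⟩ := exists_enumeration_of_tuple x
    refine exists_tuple_of_range_eq (y := f ∘ y) ?_ (hs _ _ _ _ hw
      (hcδ ▸ weight_le_add hp (by omega) hfg.nonneg fun i j => hf _ _))
    rw [Set.range_comp, Set.range_comp, hy]
  have prism_mem : ∀ (Z : Type u) [MetricSpace Z] [LinearOrder Z] (w : Z → Z)
      (_ : ∀ a, dist (w a) a ≤ δ) (r : ℝ) (m : ℕ) (_ : m ≤ n)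
      (x : Tuple (vrComplex Z p (scale.obj r)) m) (i : Fin (m + 1)),
      ∃ t : Tuple (vrComplex Z p (scale.obj (r + c + c))) (m + 1),
        t.1 = Fin.cons (w (x.1 i)) (moveAbove w x.1 i) := by
    intro Z _ _ w hw r m hm x i
    obtain ⟨k, hk, y, hy, hyw⟩ := exists_enumeration_of_tuple x
    obtain ⟨a, ha⟩ : x.1 i ∈ Set.range y := hy ▸ Set.mem_range_self i
    obtain _ | k := k
    · exact a.elim0
    let v : Z → Z := fun q => if q ≤ x.1 i then q else w q
    -- The minimising enumeration `y` with the prism's moves applied to its entries, and the extra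
    -- vertex `w (x i)` inserted right after the position `a` of `x i`. So `z` lies entrywise within
    -- `δ` of `y` with its entry at `a` repeated, wherever the linear order places `x i`.
    let z : Fin (k + 2) → Z := a.succ.insertNth (w (x.1 i)) (v ∘ y)
    have hz : ∀ l, dist (z l) (y (a.predAbove l)) ≤ δ := by
      intro l
      refine a.succ.succAboveCases ?_ (fun l => ?_) l
      · simp only [z, Fin.insertNth_apply_same, Fin.predAbove_succ_self, ha]
        exact hw _
      · have e : a.predAbove (a.succ.succAbove l) = l := by
          ext
          simp only [predAbove_val, succAbove_val, Fin.val_succ]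
          split_ifs <;> omega
        simp only [z, Fin.insertNth_apply_succAbove, e, v, Function.comp]
        split_ifs
        · simpa using hfg.nonneg
        · exact hw _
    have h₁ : weight p (y ∘ a.predAbove) ≤ weight p y :=
      weight_comp_le p y _ (Fin.predAbove_right_monotone a)
    have h₂ := weight_le_add (N := n + 2) hp (by omega) (by linarith [hfg.nonneg])
      (dist_le_add_of_dist_le (x := y ∘ a.predAbove) hz)
    refine exists_tuple_of_range_eq (y := z) ?_ (hs.mem_add_add hyw (by linarith))
    have e : moveAbove w x.1 i = v ∘ x.1 := rfl
    rw [Fin.range_insertNth, Fin.range_cons, e, Set.range_comp, Set.range_comp, hy]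
    rfl
  exact interleaved_complexHomology R (scale ⋙ (vrComplex_mono X p).functor)
    (scale ⋙ (vrComplex_mono Y p).functor) f g n c hc (map_mem X Y f hfg.dist_map_le)
    (map_mem Y X g hfg.dist_inv_le) (prism_mem X (g ∘ f) hfg.dist_left_le)
    (prism_mem Y (f ∘ g) hfg.dist_right_le)

end Stability

/-! ### The distance bounds; for `p = ∞` the exponent `(1 / p).toReal` is `0` and the factor is `1`.
-/

section Bounds

variable (X Y : Type u) [MetricSpace X] [MetricSpace Y] (R : Type v) [CommRing R]
  (n : ℕ) {scale : ℝ ⥤ LowerSet ℝ}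

lemma ofReal_add_two_rpow (n : ℕ) (s : ℝ) (hs : 0 ≤ s) :
    ENNReal.ofReal (((n + 2 : ℕ) : ℝ) ^ s) = ((n : ENNReal) + 2) ^ s := by
  rw [← ENNReal.ofReal_rpow_of_nonneg (by positivity) hs, ENNReal.ofReal_natCast]
  push_cast
  rfl

theorem interleavingDist_vrSSetModule_le (hs : IsScale scale) {p : ENNReal} (hp : 1 ≤ p) :
    interleavingDist (vrSSetModule X R scale p n) (vrSSetModule Y R scale p n) ≤
      2 * ((n : ENNReal) + 2) ^ (1 / p).toReal * ghEDist X Y := by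
  refine interleavingDist_le_mul_ghEDist _ _ (((n + 2 : ℕ) : ℝ) ^ (1 / p).toReal) (by positivity) _
    (ofReal_add_two_rpow n _ ENNReal.toReal_nonneg) fun η hη h => ?_
  obtain ⟨f, g, hfg⟩ := exists_almostInverse_of_ghEDist_lt hη h
  exact interleaved_vrSSetModule R n hfg hs hp _ rfl

theorem interleavingDist_vrComplexModule_le (hs : IsScale scale) {p : ENNReal} (hp : 1 ≤ p) :
    interleavingDist (vrComplexModule X R scale p n) (vrComplexModule Y R scale p n) ≤
      2 * ((n : ENNReal) + 2) ^ (1 / p).toReal * ghEDist X Y := by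
  refine interleavingDist_le_mul_ghEDist _ _ (((n + 2 : ℕ) : ℝ) ^ (1 / p).toReal) (by positivity) _
    (ofReal_add_two_rpow n _ ENNReal.toReal_nonneg) fun η hη h => ?_
  obtain ⟨f, g, hfg⟩ := exists_almostInverse_of_ghEDist_lt hη h
  exact interleaved_vrComplexModule R n hfg hs hp _ rfl

theorem interleavingDist_blurredMagnitudeHomology_le (hs : IsScale scale) :
    interleavingDist (blurredMagnitudeHomology X R scale n) (blurredMagnitudeHomology Y R scale n) ≤
      2 * ((n : ENNReal) + 2) * ghEDist X Y := by
  refine interleavingDist_le_mul_ghEDist _ _ ((n + 2 : ℕ) : ℝ) (by positivity) _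
    (by simpa using ofReal_add_two_rpow n 1 zero_le_one) fun η hη h => ?_
  obtain ⟨f, g, hfg⟩ := exists_almostInverse_of_ghEDist_lt hη h
  exact interleaved_blurredMagnitudeHomology R n hfg hs _ rfl

end Bounds

end LpVR

theorem mainTheorem2 {X Y : Type u} [MetricSpace X] [MetricSpace Y] {R : Type v} [CommRing R]
    (n : ℕ) (p : ENNReal) (hp : 1 ≤ p) :
    (LpVR.interleavingDist (LpVR.vrSSetModule X R LpVR.strictScale p n)
        (LpVR.vrSSetModule Y R LpVR.strictScale p n)
      ≤ 2 * ((n : ENNReal) + 2) ^ (1 / p).toReal * LpVR.ghEDist X Y) ∧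
    (LpVR.interleavingDist (LpVR.vrSSetModule X R LpVR.nonstrictScale p n)
        (LpVR.vrSSetModule Y R LpVR.nonstrictScale p n)
      ≤ 2 * ((n : ENNReal) + 2) ^ (1 / p).toReal * LpVR.ghEDist X Y) ∧
    (LpVR.interleavingDist (LpVR.vrComplexModule X R LpVR.strictScale p n)
        (LpVR.vrComplexModule Y R LpVR.strictScale p n)
      ≤ 2 * ((n : ENNReal) + 2) ^ (1 / p).toReal * LpVR.ghEDist X Y) ∧
    (LpVR.interleavingDist (LpVR.vrComplexModule X R LpVR.nonstrictScale p n)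
        (LpVR.vrComplexModule Y R LpVR.nonstrictScale p n)
      ≤ 2 * ((n : ENNReal) + 2) ^ (1 / p).toReal * LpVR.ghEDist X Y) ∧
    (LpVR.interleavingDist (LpVR.blurredMagnitudeHomology X R LpVR.strictScale n)
        (LpVR.blurredMagnitudeHomology Y R LpVR.strictScale n)
      ≤ 2 * ((n : ENNReal) + 2) * LpVR.ghEDist X Y) ∧
    (LpVR.interleavingDist (LpVR.blurredMagnitudeHomology X R LpVR.nonstrictScale n)
        (LpVR.blurredMagnitudeHomology Y R LpVR.nonstrictScale n)
      ≤ 2 * ((n : ENNReal) + 2) * LpVR.ghEDist X Y) :=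
  ⟨LpVR.interleavingDist_vrSSetModule_le X Y R n LpVR.isScale_strictScale hp,
    LpVR.interleavingDist_vrSSetModule_le X Y R n LpVR.isScale_nonstrictScale hp,
    LpVR.interleavingDist_vrComplexModule_le X Y R n LpVR.isScale_strictScale hp,
    LpVR.interleavingDist_vrComplexModule_le X Y R n LpVR.isScale_nonstrictScale hp,
    LpVR.interleavingDist_blurredMagnitudeHomology_le X Y R n LpVR.isScale_strictScale,
    LpVR.interleavingDist_blurredMagnitudeHomology_le X Y R n LpVR.isScale_nonstrictScale⟩
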